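/- **Setting.** Binary trees are rooted ordered trees in which every node has a possibly empty left and a possibly empty right subtree; the empty tree $\Lambda$ is included. $|t|$ is the number of nodes, $h(t)$ the height ($h(\Lambda)=0$, $h(t)=1+\max(h(t_\ell),h(t_r))$), $\mathcal T_n$ the set of binary trees with $n$ nodes; $t_\ell[v],t_r[v]$ are the left and right subtrees of a node $v$ of $t$, and $\lg=\log_2$. A *fixed-size source* is a function $p:\mathbb N_0^2\to[0,1]$ with $\sum_{\ell=0}^n p(\ell,n-\ell)=1$ for all $n\in\mathbb N_0$; it assigns to $t$ the probability $\mathbb P[t]=\prod_{v\in t}p(|t_\ell[v]|,|t_r[v]|)$. A *fixed-height source* is a function $p:\mathbb N_0^2\to[0,1]$ with $\sum_{\max(i,j)=h}p(i,j)=1$ for all $h\in\mathbb N_0$; it assigns to $t$ the probability $\mathbb P[t]=\prod_{v\in t}p(h(t_\ell[v]),h(t_r[v]))$. In both cases $\mathbb P[\Lambda]=1$. The source is *monotonic* if $p(\ell,r)\ge p(\ell+1,r)$ and $p(\ell,r)\ge p(\ell,r+1)$ for all $\ell,r\in\mathbb N_0$. **Micro trees.** For $t\in\mathcal T_n$ put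 $B=\lceil\frac18\lg n\rceil$ and $\mu=\lceil\frac14\lg n\rceil$ (both $0$ for $n=0$). A node is *heavy* if its subtree in $t$ has at least $B$ nodes. The Farzan–Munro algorithm proceeds bottom-up. If both children of $v$ are heavy, then $\{v\}$ and the components of both children become permanent. Otherwise the component of $v$ consists of $v$ and the components of those children whose component is not yet permanent, and it becomes permanent if it has at least $B$ nodes. At the end the component of the root becomes permanent. The components are the micro trees $\mu_1,\dots,\mu_m$ of $t$. Contracting each of them to a node gives the top tier tree $\Upsilon$, a binary tree with $m$ nodes; a child micro tree is a left (right) child in $\Upsilon$ if it lies in the left (right) subtree of the root of the parent micro tree. The null pointers of a micro tree that lead to its child micro trees are its *portals*. **Hypersuccinct code.** Let $\gamma(k)$ be the Elias gamma code and $\mathit{BP}$ the balanced-parenthesis code of binary trees, $\mathit{BP}(\Lambda)=\varepsilon$, $\mathit{BP}(t)=\texttt(\,\mathit{BP}(t_\ell)\,\texttt)\,\mathit{BP}(t_r)$. Let $C$ be a Huffman code (result of Huffman's algorithm, ties broken arbitrarily) for the sequence $\mu_1,\dots,\mu_m$ of shapes of micro trees, and let $\bar C(\sigma)=\texttt0\,\gamma(|\sigma|+1)\,\mathit{BP}(\sigma)$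 if $|C(\sigma)|>2|\sigma|+2\lfloor\lg(|\sigma|+1)\rfloor$ and $\bar C(\sigma)=\texttt1\,C(\sigma)$ otherwise. A hypersuccinct code is a map $\mathsf H$ from binary trees to $\{0,1\}^\star$ for which $\mathsf H(t)$ is, for every $t$ and some such $C$, the concatenation of: (1) $\gamma(n+1)\gamma(m+1)$; (2) $\mathit{BP}(\Upsilon)$; (3) the code table, that is, the number of occurring shapes plus one in gamma code, followed, for every occurring shape $\sigma$, by $\gamma(|\bar C(\sigma)|)\,\bar C(\sigma)\,\gamma(|\sigma|)\,\mathit{BP}(\sigma)$; (4) $\bar C(\mu_1)\cdots\bar C(\mu_m)$ in depth-first order of $\Upsilon$; (5) for every micro tree in the same order, the ranks, from left to right among its null pointers starting with $0$, of its left and its right portal ($0$ if there is none), with $\lceil\lg(\mu+1)\rceil$ bits each. **Theorem (Universality for monotonic sources).** 1. There is a function $R:\mathbb N_0\to\mathbb R$ with $R(n)=O(n\log\log n/\log n)$ such that for every hypersuccinct code $\mathsf H$, every monotonic fixed-size or fixed-height source $p$, every $n\in\mathbb N_0$ and every $t\in\mathcal T_n$ with $\mathbb P[t]>0$, $$|\mathsf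 H(t)|\le\lg\frac1{\mathbb P[t]}+R(n).$$ 2. For every monotonic fixed-size or fixed-height source and every binary tree $t$ with micro trees $\mu_1,\dots,\mu_m$, $\mathbb P[t]\le\prod_{i=1}^m\mathbb P[\mu_i]$. 3. The random binary search tree source $p_{\mathit{bst}}(\ell,r)=\frac1{\ell+r+1}$ and the source $p_{\mathit{uni}}(\ell,r)=\frac{|\mathcal T_\ell||\mathcal T_r|}{|\mathcal T_{\ell+r+1}|}$ are monotonic fixed-size sources, and the latter induces the uniform distribution: $\mathbb P[t]=1/|\mathcal T_n|$ for every $t\in\mathcal T_n$. -/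

import Mathlib

namespace Hypersuccinct

/-! ### Binary trees

A binary tree is a term of `BinaryTree Unit`: `nil` is the empty tree, `numNodes` is the size and
`height` is the height (with `height nil = 0`).  The finset of the trees with `n` nodes is
`BinaryTree.treesOfNumNodesEq n`. -/

/-- The node labels of a labelled binary tree in depth-first order (preorder). -/
def preorder {α : Type*} : BinaryTree α → List α
  | .nil => []
  | .node a l r => a :: (preorder l ++ preorder r)

/-- Balanced-parenthesis encoding of the shape of a binary tree:
`true` is an opening and `false` a closing parenthesis. -/
def bp {α : Type*} : BinaryTree α → List Bool
  | .nil => []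
  | .node _ l r => true :: (bp l ++ false :: bp r)

/-! ### Binary tree sources -/

/-- `p : ℕ₀² → [0,1]` defines a fixed-size binary tree source. -/
structure IsFixedSizeSource (p : ℕ → ℕ → ℝ) : Prop where
  nonneg : ∀ l r, 0 ≤ p l r
  le_one : ∀ l r, p l r ≤ 1
  sum_eq_one : ∀ n : ℕ, ∑ l ∈ Finset.range (n + 1), p l (n - l) = 1

/-- `p : ℕ₀² → [0,1]` defines a fixed-height binary tree source. -/
structure IsFixedHeightSource (p : ℕ → ℕ → ℝ) : Prop where
  nonneg : ∀ l r, 0 ≤ p l r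
  le_one : ∀ l r, p l r ≤ 1
  sum_eq_one : ∀ h : ℕ,
    ∑ ij ∈ (Finset.range (h + 1) ×ˢ Finset.range (h + 1)).filter (fun ij => max ij.1 ij.2 = h),
      p ij.1 ij.2 = 1

/-- `p` is nonincreasing in each of its arguments. -/
def IsMonotonic (p : ℕ → ℕ → ℝ) : Prop :=
  ∀ l r : ℕ, p (l + 1) r ≤ p l r ∧ p l (r + 1) ≤ p l r

/-- Probability of a tree under the fixed-size source `p`:
the product over all nodes `v` of `p (|t_ℓ[v]|) (|t_r[v]|)`. -/
noncomputable def fixedSizeProb (p : ℕ → ℕ → ℝ) : BinaryTree Unit → ℝ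
  | .nil => 1
  | .node _ l r => p l.numNodes r.numNodes * (fixedSizeProb p l * fixedSizeProb p r)

/-- Probability of a tree under the fixed-height source `p`:
the product over all nodes `v` of `p (h (t_ℓ[v])) (h (t_r[v]))`. -/
noncomputable def fixedHeightProb (p : ℕ → ℕ → ℝ) : BinaryTree Unit → ℝ
  | .nil => 1
  | .node _ l r => p l.height r.height * (fixedHeightProb p l * fixedHeightProb p r)

/-- The random binary search tree source: all splits are equally likely. -/
noncomputable def bstSource (l r : ℕ) : ℝ := 1 / ((l : ℝ) + r + 1)

/-- The uniform source. -/
noncomputable def uniformSource (l r : ℕ) : ℝ :=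
  ((BinaryTree.treesOfNumNodesEq l).card : ℝ) * (BinaryTree.treesOfNumNodesEq r).card /
    (BinaryTree.treesOfNumNodesEq (l + r + 1)).card

/-! ### The Farzan-Munro decomposition of a binary tree into micro trees -/

/-- A node is heavy if the subtree rooted at it has at least `B` nodes; `nil` is not a node. -/
def IsHeavy (B : ℕ) (t : BinaryTree Unit) : Prop := t ≠ .nil ∧ B ≤ t.numNodes

instance (B : ℕ) (t : BinaryTree Unit) : Decidable (IsHeavy B t) := by
  unfold IsHeavy; infer_instance

/-- Set the label of the root (if there is one). -/
def setRoot (c : Bool) : BinaryTree Bool → BinaryTree Bool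
  | .nil => .nil
  | .node _ l r => .node c l r

/-- State of the bottom-up decomposition after a subtree has been processed. -/
structure PackState where
  /-- the subtree, with the roots of the finished components labelled `true`;
  its root, which belongs to the active component, is still labelled `false` -/
  marks : BinaryTree Bool
  /-- number of nodes of the active component (the component of the root of the subtree) -/
  size : ℕ
  /-- whether the active component has been declared permanent -/
  permanent : Bool

/-- Bottom-up greedy packing with parameter `B`.  At a node with two heavy children (a branching
node) the node forms a permanent component of its own, and the components of both children become
permanent.  Otherwise the component of the node consists of the node and of the active components
of those children whose component is not yet permanent; it is declared permanent as soon as it has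
at least `B` nodes. -/
def pack (B : ℕ) : BinaryTree Unit → PackState
  | .nil => ⟨.nil, 0, false⟩
  | .node _ l r =>
    let L := pack B l
    let R := pack B r
    let branching : Bool := decide (IsHeavy B l ∧ IsHeavy B r)
    let cutL := L.permanent || branching
    let cutR := R.permanent || branching
    let size := 1 + (if cutL then 0 else L.size) + (if cutR then 0 else R.size)
    ⟨.node false (setRoot cutL L.marks) (setRoot cutR R.marks), size,
      branching || decide (B ≤ size)⟩

/-- The tree with exactly the roots of its micro trees labelled `true`. -/
def microRoots (B : ℕ) (t : BinaryTree Unit) : BinaryTree Bool := setRoot true (pack B t).marks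

/-- The data stored for a micro tree: its shape, and the ranks (from left to right, starting with
`0`, among all its null pointers) of the null pointers leading to a child micro tree in the left
resp. right subtree of its root (`0` if there is no such child). -/
structure MicroTree where
  shape : BinaryTree Unit
  leftPortal : ℕ
  rightPortal : ℕ

/-- Contract the micro trees of a tree whose micro-tree roots are labelled `true`.  Returns the
shape that remains after removing all subtrees rooted at micro-tree roots, and, from left to right,
the removed (maximal) subtrees, each one contracted to its top tier tree and paired with the rank
of the null pointer that it leaves. -/
def contract : BinaryTree Bool → BinaryTree Unit × List (ℕ × BinaryTree MicroTree)
  | .nil => (.nil, [])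
  | .node c l r =>
    let L := contract l
    let R := contract r
    let shape : BinaryTree Unit := .node () L.1 R.1
    let extL := L.2
    let extR := R.2.map fun x => (x.1 + L.1.numNodes + 1, x.2)
    if c then
      (.nil, [(0, .node
        ⟨shape, (extL.head?.map Prod.fst).getD 0, (extR.head?.map Prod.fst).getD 0⟩
        ((extL.head?.map Prod.snd).getD .nil) ((extR.head?.map Prod.snd).getD .nil))])
    else (shape, extL ++ extR)

/-- The top tier tree `Υ` of `t`: every micro tree is contracted to a single node, which is
labelled by the data of the micro tree. -/
def topTier (B : ℕ) (t : BinaryTree Unit) : BinaryTree MicroTree :=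
  ((contract (microRoots B t)).2.head?.map Prod.snd).getD .nil

/-- The shapes of the micro trees `μ₁, …, μₘ` of `t`, in depth-first order of the top tier. -/
def microShapes (B : ℕ) (t : BinaryTree Unit) : List (BinaryTree Unit) :=
  (preorder (topTier B t)).map MicroTree.shape

/-! ### Huffman codes -/

/-- Binary code trees with symbols at the leaves. -/
inductive CodeTree (α : Type*) where
  | leaf (a : α) : CodeTree α
  | node (l r : CodeTree α) : CodeTree α

/-- The symbols of a code tree with their codewords. -/
def CodeTree.codes {α : Type*} : CodeTree α → List (α × List Bool)
  | .leaf a => [(a, [])]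
  | .node l r =>
    l.codes.map (fun x => (x.1, false :: x.2)) ++ r.codes.map (fun x => (x.1, true :: x.2))

/-- Runs of Huffman's algorithm on a forest of weighted code trees: as long as there are at least
two trees, two trees of smallest weight are merged (ties are broken arbitrarily). -/
inductive HuffmanRun {α : Type*} : Multiset (ℕ × CodeTree α) → CodeTree α → Prop
  | single (w : ℕ) (T : CodeTree α) : HuffmanRun {(w, T)} T
  | merge (x y : ℕ × CodeTree α) (F : Multiset (ℕ × CodeTree α)) (T : CodeTree α)
      (hmin : ∀ z ∈ F, x.1 ≤ z.1 ∧ y.1 ≤ z.1)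
      (h : HuffmanRun ((x.1 + y.1, CodeTree.node x.2 y.2) ::ₘ F) T) :
      HuffmanRun (x ::ₘ y ::ₘ F) T

/-- The initial forest for the word `s`: a leaf for every symbol that occurs in `s`, weighted by its
number of occurrences. -/
def huffmanForest {α : Type*} [DecidableEq α] (s : List α) : Multiset (ℕ × CodeTree α) :=
  s.toFinset.val.map fun a => (s.count a, CodeTree.leaf a)

/-- `C` is a Huffman code for the word `s` (no condition if `s` is empty; the values of `C` outside
of the symbols of `s` are irrelevant). -/
def IsHuffmanCode {α : Type*} [DecidableEq α] (s : List α) (C : α → List Bool) : Prop :=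
  s ≠ [] → ∃ T, HuffmanRun (huffmanForest s) T ∧ ∀ a ∈ s, (a, C a) ∈ T.codes

/-! ### The hypersuccinct code -/

/-- The `w` lowest bits of `k`, most significant bit first. -/
def fixedWidth (w k : ℕ) : List Bool := (List.range w).map fun i => k.testBit (w - 1 - i)

/-- The Elias gamma code of `k ≥ 1`, of length `2 ⌊lg k⌋ + 1`. -/
def eliasGamma (k : ℕ) : List Bool :=
  List.replicate (Nat.log 2 k) false ++ fixedWidth (Nat.log 2 k + 1) k

/-- The length-restricted version of a code for binary trees. -/
def lengthRestrict (C : BinaryTree Unit → List Bool) (t : BinaryTree Unit) : List Bool :=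
  if 2 * t.numNodes + 2 * Nat.log 2 (t.numNodes + 1) < (C t).length then
    false :: (eliasGamma (t.numNodes + 1) ++ bp t)
  else true :: C t

/-- The code word of a tree with `n` nodes and top tier `Υ`, where `C` is a code for the shapes of
micro trees and `w` is the number of bits of a portal.  The five parts are: the number of nodes and
the number of micro trees (each plus one, because of the empty tree); the balanced-parenthesis word
of `Υ`; the code table; the codewords of the micro trees; the portals. -/
def codeWord (n w : ℕ) (C : BinaryTree Unit → List Bool) (Υ : BinaryTree MicroTree) : List Bool :=
  let micros := preorder Υ
  let shapes := micros.map MicroTree.shape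
  let alphabet := shapes.dedup
  (eliasGamma (n + 1) ++ eliasGamma (micros.length + 1)) ++
  bp Υ ++
  (eliasGamma (alphabet.length + 1) ++
    alphabet.flatMap fun s =>
      eliasGamma (lengthRestrict C s).length ++ lengthRestrict C s ++
        eliasGamma s.numNodes ++ bp s) ++
  shapes.flatMap (lengthRestrict C) ++
  micros.flatMap fun m => fixedWidth w m.leftPortal ++ fixedWidth w m.rightPortal

/-- The parameter `B = ⌈lg n / 8⌉` of the decomposition. -/
noncomputable def blockParam (n : ℕ) : ℕ := ⌈Real.logb 2 n / 8⌉₊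

/-- The maximal size `μ = ⌈lg n / 4⌉` of a micro tree. -/
noncomputable def microBound (n : ℕ) : ℕ := ⌈Real.logb 2 n / 4⌉₊

/-- The number `⌈lg (μ + 1)⌉` of bits of a portal. -/
noncomputable def portalWidth (n : ℕ) : ℕ := ⌈Real.logb 2 ((microBound n : ℝ) + 1)⌉₊

/-- The micro trees `μ₁, …, μₘ` (as shapes) used by the hypersuccinct code. -/
noncomputable def microTrees (t : BinaryTree Unit) : List (BinaryTree Unit) :=
  microShapes (blockParam t.numNodes) t

/-- `H` is a hypersuccinct code: for every tree `t` its code word is formed with some Huffman code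
for the sequence of the micro trees of `t`. -/
def IsHypersuccinctCode (H : BinaryTree Unit → List Bool) : Prop :=
  ∀ t : BinaryTree Unit, ∃ C : BinaryTree Unit → List Bool,
    IsHuffmanCode (microTrees t) C ∧
      H t = codeWord t.numNodes (portalWidth t.numNodes) C (topTier (blockParam t.numNodes) t)

/-! ### Existence of hypersuccinct codes -/

theorem exists_huffmanRun {α : Type*} (k : ℕ) :
    ∀ F : Multiset (ℕ × CodeTree α), F.card = k + 1 → ∃ T, HuffmanRun F T := by
  induction k with
  | zero =>
    intro F hF
    obtain ⟨a, rfl⟩ := Multiset.card_eq_one.1 (by simpa using hF)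
    exact ⟨a.2, HuffmanRun.single a.1 a.2⟩
  | succ k ih =>
    intro F hF
    have key : ∀ G : Multiset (ℕ × CodeTree α), 0 < G.card →
        ∃ x F', G = x ::ₘ F' ∧ ∀ z ∈ G, x.1 ≤ z.1 := by
      intro G hG
      obtain ⟨b, hb⟩ := Multiset.card_pos_iff_exists_mem.1 hG
      classical
      obtain ⟨x, hx, hmin⟩ := Finset.exists_min_image G.toFinset (fun z => z.1)
        ⟨b, Multiset.mem_toFinset.2 hb⟩
      obtain ⟨F', hF'⟩ := Multiset.exists_cons_of_mem (Multiset.mem_toFinset.1 hx)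
      exact ⟨x, F', hF', fun z hz => hmin z (Multiset.mem_toFinset.2 hz)⟩
    obtain ⟨x, F₁, rfl, hx⟩ := key F (by omega)
    obtain ⟨y, F₂, rfl, hy⟩ := key F₁ (by simp at hF; omega)
    obtain ⟨T, hT⟩ := ih ((x.1 + y.1, CodeTree.node x.2 y.2) ::ₘ F₂) (by simp at hF ⊢; omega)
    exact ⟨T, HuffmanRun.merge x y F₂ T
      (fun z hz => ⟨hx z (by simp [hz]), hy z (by simp [hz])⟩) hT⟩

theorem HuffmanRun.mem_codes {α : Type*} {F : Multiset (ℕ × CodeTree α)} {T : CodeTree α}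
    (h : HuffmanRun F T) (a : α) (hF : ∃ x ∈ F, ∃ w, (a, w) ∈ x.2.codes) :
    ∃ w, (a, w) ∈ T.codes := by
  induction h with
  | single w T => simpa using hF
  | merge x y F T hmin h ih =>
    apply ih
    obtain ⟨z, hz, w, hw⟩ := hF
    rcases Multiset.mem_cons.1 hz with rfl | hz
    · exact ⟨_, Multiset.mem_cons_self _ _, false :: w, by simp [CodeTree.codes, hw]⟩
    rcases Multiset.mem_cons.1 hz with rfl | hz
    · exact ⟨_, Multiset.mem_cons_self _ _, true :: w, by simp [CodeTree.codes, hw]⟩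
    · exact ⟨z, Multiset.mem_cons_of_mem hz, w, hw⟩

theorem exists_isHuffmanCode {α : Type*} [DecidableEq α] (s : List α) :
    ∃ C : α → List Bool, IsHuffmanCode s C := by
  by_cases hs : s = []
  · exact ⟨fun _ => [], fun h => absurd hs h⟩
  · have hpos : 0 < (huffmanForest s).card := by
      obtain ⟨a, ha⟩ := List.exists_mem_of_ne_nil s hs
      refine Multiset.card_pos_iff_exists_mem.2 ⟨(s.count a, CodeTree.leaf a), ?_⟩
      exact Multiset.mem_map.2 ⟨a, by simpa using ha, rfl⟩
    obtain ⟨T, hT⟩ := exists_huffmanRun ((huffmanForest s).card - 1) (huffmanForest s) (by omega)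
    have hmem : ∀ a, ∃ w, a ∈ s → (a, w) ∈ T.codes := by
      intro a
      by_cases ha : a ∈ s
      · obtain ⟨w, hw⟩ := hT.mem_codes a ⟨(s.count a, CodeTree.leaf a),
          Multiset.mem_map.2 ⟨a, by simpa using ha, rfl⟩, [], by simp [CodeTree.codes]⟩
        exact ⟨w, fun _ => hw⟩
      · exact ⟨[], fun h => absurd h ha⟩
    choose C hC using hmem
    exact ⟨C, fun _ => ⟨T, hT, hC⟩⟩

theorem exists_isHypersuccinctCode : ∃ H, IsHypersuccinctCode H := by
  choose C hC using fun t : BinaryTree Unit => exists_isHuffmanCode (microTrees t)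
  exact ⟨fun t => codeWord t.numNodes (portalWidth t.numNodes) (C t)
    (topTier (blockParam t.numNodes) t), fun t => ⟨C t, hC t, rfl⟩⟩

end Hypersuccinct

namespace Hypersuccinct

/-! Cutting a tree into micro trees can only raise its probability. A node of a micro tree keeps its
place, but its left and right subtrees lose whatever hangs below the portals, so their size or
height does not grow. Monotonicity then gives a larger factor `p`, and the product over all nodes
yields `P[t] ≤ ∏ P[μᵢ]` (`IsSource.treeProb_le_prod_microShapes`). Size and height enter only
through `IsSizeRule`, so both kinds of sources are treated at once.

A Huffman code is no longer than any assignment of lengths satisfying Kraft's inequality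
(`IsHuffmanCode.sum_length_le`). Micro trees have at most `K = 2B + 1` nodes, and trees of one fixed
measure have total probability at most `1`, so `P[σ] / (K + 1)` has total mass at most `1` over the
occurring shapes. Comparing with its Shannon lengths bounds the sum of the lengths of the Huffman
codewords of the micro trees by `∑ lg (1 / P[μᵢ]) + m (lg (K + 1) + 1)`, hence by `lg (1 / P[t])`
plus `O(log log n)` bits per micro tree. The comparison code depends on the source, but the error
does not.

The rest is overhead. There are `m = O(n / log n)` micro trees (`mul_length_microShapes_le`), each
with two portals of `O(log log n)` bits. At most `4 ^ (2B + 2) = O(√n)` shapes occur, so the code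
table costs `O(√n log n)` bits. -/

/-! ### Shapes and number of the micro trees -/

/-- The shapes of all micro trees in a list of contracted subtrees. -/
def extShapes (e : List (ℕ × BinaryTree MicroTree)) : List (BinaryTree Unit) :=
  e.flatMap fun x => (preorder x.2).map MicroTree.shape

theorem extShapes_append (e f : List (ℕ × BinaryTree MicroTree)) :
    extShapes (e ++ f) = extShapes e ++ extShapes f := by
  simp [extShapes]

theorem extShapes_map_fst (e : List (ℕ × BinaryTree MicroTree)) (k : ℕ) :
    extShapes (e.map fun x => (x.1 + k, x.2)) = extShapes e := by
  simp [extShapes, List.flatMap_map]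

/-- When a micro tree is closed, `contract` keeps only the first piece on each side. A sublist
relation is enough: discarding pieces only lowers their number and raises the product of their
probabilities. Hence uniqueness of the portal on each side is never needed. -/
theorem map_shape_preorder_head_sublist (e : List (ℕ × BinaryTree MicroTree)) :
    ((preorder ((e.head?.map Prod.snd).getD .nil)).map MicroTree.shape).Sublist (extShapes e) := by
  cases e with
  | nil => simp [preorder]
  | cons x e => simp [extShapes]

theorem extShapes_contract_nil : extShapes (contract .nil).2 = [] := by
  simp [contract, extShapes]

theorem contract_node_true_fst (l r : BinaryTree Bool) :
    (contract (.node true l r)).1 = .nil := by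
  simp [contract]

theorem contract_node_false_fst (l r : BinaryTree Bool) :
    (contract (.node false l r)).1 = .node () (contract l).1 (contract r).1 := by
  simp [contract]

theorem extShapes_contract_node_false (l r : BinaryTree Bool) :
    extShapes (contract (.node false l r)).2 =
      extShapes (contract l).2 ++ extShapes (contract r).2 := by
  simp [contract, extShapes_append, ← extShapes_map_fst (contract r).2 ((contract l).1.numNodes + 1),
    add_assoc]

theorem extShapes_contract_node_true_sublist (l r : BinaryTree Bool) :
    (extShapes (contract (.node true l r)).2).Sublist
      (.node () (contract l).1 (contract r).1 ::
        (extShapes (contract l).2 ++ extShapes (contract r).2)) := by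
  have hr := map_shape_preorder_head_sublist
    ((contract r).2.map fun x => (x.1 + ((contract l).1.numNodes + 1), x.2))
  rw [extShapes_map_fst] at hr
  have hl := map_shape_preorder_head_sublist (contract l).2
  have h := hl.append hr
  simpa [contract, extShapes, preorder, add_assoc] using h

theorem microShapes_sublist (B : ℕ) (t : BinaryTree Unit) :
    (microShapes B t).Sublist (extShapes (contract (microRoots B t)).2) :=
  map_shape_preorder_head_sublist _

/-- The number of nodes labelled `true`. -/
def numTrue : BinaryTree Bool → ℕ
  | .nil => 0
  | .node c l r => c.toNat + numTrue l + numTrue r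

theorem length_extShapes_contract_le (τ : BinaryTree Bool) :
    (extShapes (contract τ).2).length ≤ numTrue τ := by
  induction τ with
  | nil => simp [extShapes_contract_nil]
  | node c l r hl hr =>
    cases c with
    | false =>
      rw [extShapes_contract_node_false]
      simp only [List.length_append, numTrue, Bool.toNat_false]
      omega
    | true =>
      have := (extShapes_contract_node_true_sublist l r).length_le
      simp only [List.length_cons, List.length_append] at this
      simp only [numTrue, Bool.toNat_true]
      omega

/-! ### Sizes of the components -/

theorem pack_marks_cases (B : ℕ) (t : BinaryTree Unit) :
    ((pack B t).marks = .nil ∧ t = .nil) ∨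
      ∃ l r, (pack B t).marks = .node false l r := by
  cases t with
  | nil => simp [pack]
  | node _ l r => simp [pack]

theorem numTrue_setRoot_pack_le (B : ℕ) (t : BinaryTree Unit) (c : Bool) :
    numTrue (setRoot c (pack B t).marks) ≤ c.toNat + numTrue (pack B t).marks := by
  obtain ⟨h, -⟩ | ⟨l, r, h⟩ := pack_marks_cases B t <;> simp [h, setRoot, numTrue, add_assoc]

theorem contract_setRoot_pack_fst (B : ℕ) (t : BinaryTree Unit) (c : Bool) :
    (contract (setRoot c (pack B t).marks)).1 =
      if c then .nil else (contract (pack B t).marks).1 := by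
  obtain ⟨h, -⟩ | ⟨l, r, h⟩ := pack_marks_cases B t <;> cases c <;> simp [h, setRoot, contract]

/-- Marking the root of a processed subtree releases one new micro tree at most, namely its active
component. -/
theorem extShapes_contract_setRoot_pack_sublist (B : ℕ) (t : BinaryTree Unit) (c : Bool) :
    (extShapes (contract (setRoot c (pack B t).marks)).2).Sublist
      ((contract (pack B t).marks).1 :: extShapes (contract (pack B t).marks).2) := by
  obtain ⟨h, -⟩ | ⟨l, r, h⟩ := pack_marks_cases B t
  · simp [h, setRoot, contract, extShapes]
  · rw [h, setRoot]
    cases c with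
    | false => exact List.sublist_cons_self _ _
    | true =>
      rw [contract_node_false_fst, extShapes_contract_node_false]
      exact extShapes_contract_node_true_sublist l r

theorem numNodes_contract_pack (B : ℕ) (t : BinaryTree Unit) :
    (contract (pack B t).marks).1.numNodes = (pack B t).size := by
  induction t with
  | nil => simp [pack, contract]
  | node _ l r hl hr =>
    simp only [pack, contract_node_false_fst, BinaryTree.numNodes, contract_setRoot_pack_fst]
    rw [← hl, ← hr, apply_ite BinaryTree.numNodes, apply_ite BinaryTree.numNodes,
      BinaryTree.numNodes, add_comm, add_assoc]

theorem pack_size_le_of_not_permanent (B : ℕ) (t : BinaryTree Unit)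
    (h : (pack B t).permanent = false) : (pack B t).size ≤ B := by
  -- The bound is not strict because of the empty tree with `B = 0`; at a node the size is below
  -- `B`.
  cases t with
  | nil => simp [pack]
  | node _ l r =>
    simp only [pack, Bool.or_eq_false_iff, decide_eq_false_iff_not, not_le] at h ⊢
    exact h.2.le

/-- A node joins at most two components, and only unfinished ones. -/
theorem pack_size_le (B : ℕ) (t : BinaryTree Unit) : (pack B t).size ≤ 2 * B + 1 := by
  cases t with
  | nil => simp [pack]
  | node _ l r =>
    simp only [pack]
    have hl := pack_size_le_of_not_permanent B l
    have hr := pack_size_le_of_not_permanent B r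
    cases hpl : (pack B l).permanent <;> cases hpr : (pack B r).permanent <;>
      simp only [hpl, hpr, Bool.true_or, Bool.false_or, if_true, true_implies, reduceCtorEq,
        false_implies] at hl hr ⊢ <;> first | omega | (split_ifs <;> omega)

theorem numNodes_le_of_mem_extShapes_pack (B : ℕ) (t : BinaryTree Unit) :
    ∀ s ∈ extShapes (contract (pack B t).marks).2, s.numNodes ≤ 2 * B + 1 := by
  have key : ∀ t c, (∀ s ∈ extShapes (contract (pack B t).marks).2, s.numNodes ≤ 2 * B + 1) →
      ∀ s ∈ extShapes (contract (setRoot c (pack B t).marks)).2, s.numNodes ≤ 2 * B + 1 := by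
    intro t c h s hs
    rcases List.mem_cons.1 ((extShapes_contract_setRoot_pack_sublist B t c).subset hs) with rfl | hs
    · rw [numNodes_contract_pack]
      exact pack_size_le B t
    · exact h s hs
  induction t with
  | nil => simp [pack, extShapes_contract_nil]
  | node _ l r hl hr =>
    intro s hs
    simp only [pack, extShapes_contract_node_false, List.mem_append] at hs
    exact hs.elim (key l _ hl s) (key r _ hr s)

theorem numNodes_le_of_mem_microShapes (B : ℕ) (t s : BinaryTree Unit)
    (hs : s ∈ microShapes B t) : s.numNodes ≤ 2 * B + 1 := by
  have hs := (microShapes_sublist B t).subset hs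
  rw [microRoots] at hs
  rcases List.mem_cons.1 ((extShapes_contract_setRoot_pack_sublist B t true).subset hs) with
    rfl | hs
  · rw [numNodes_contract_pack]
    exact pack_size_le B t
  · exact numNodes_le_of_mem_extShapes_pack B t s hs

/-! ### Number of the components -/

/-- The number of branching nodes, that is, of nodes with two heavy children. -/
def numBranching (B : ℕ) : BinaryTree Unit → ℕ
  | .nil => 0
  | .node _ l r =>
    (if IsHeavy B l ∧ IsHeavy B r then 1 else 0) + numBranching B l + numBranching B r

theorem numBranching_eq_zero (B : ℕ) (t : BinaryTree Unit) (h : ¬ IsHeavy B t) :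
    numBranching B t = 0 := by
  induction t with
  | nil => rfl
  | node _ l r hl hr =>
    have hB : (BinaryTree.node () l r).numNodes < B := by
      simpa [IsHeavy] using h
    simp only [BinaryTree.numNodes] at hB
    have hl' : ¬ IsHeavy B l := fun h => by have := h.2; omega
    have hr' : ¬ IsHeavy B r := fun h => by have := h.2; omega
    simp [numBranching, hl', hl hl', hr hr']

/-- The extra `+ 1` makes the induction work: at a branching node the two surplus units of the
children pay for the node itself and for the new surplus. A light child contains no branching nodes.
-/
theorem mul_numBranching_succ_le (B : ℕ) (t : BinaryTree Unit) (h : IsHeavy B t) :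
    B * (numBranching B t + 1) ≤ t.numNodes := by
  induction t with
  | nil => exact absurd rfl h.1
  | node _ l r hl hr =>
    have hB := h.2
    simp only [BinaryTree.numNodes] at hB ⊢
    by_cases h1 : IsHeavy B l <;> by_cases h2 : IsHeavy B r
    · have := hl h1
      have := hr h2
      simp only [numBranching, h1, h2, and_self, if_true]
      nlinarith
    · have := hl h1
      simp only [numBranching, h1, h2, and_false, if_false, numBranching_eq_zero B r h2]
      simp only [zero_add, add_zero]
      omega
    · have := hr h2
      simp only [numBranching, h1, h2, false_and, if_false, numBranching_eq_zero B l h1]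
      simp only [zero_add]
      omega
    · simp [numBranching, h1, h2, numBranching_eq_zero B l h1, numBranching_eq_zero B r h2]
      omega

theorem mul_numBranching_le (B : ℕ) (t : BinaryTree Unit) :
    B * numBranching B t ≤ t.numNodes := by
  by_cases h : IsHeavy B t
  · exact (Nat.mul_le_mul_left B (Nat.le_succ _)).trans (mul_numBranching_succ_le B t h)
  · simp [numBranching_eq_zero B t h]

/-- An amortized count in which every finished component costs `B`. A component that becomes
permanent by its size is paid for by its own nodes; the nodes of an unfinished component are kept as
credit, the last term on the left. A branching node may finish itself and the components of both
children without enough nodes, whence `3 * B` for each of them. -/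
theorem mul_numTrue_pack_le (B : ℕ) (t : BinaryTree Unit) :
    B * (numTrue (pack B t).marks + (pack B t).permanent.toNat) +
        (if (pack B t).permanent then 0 else (pack B t).size) ≤
      t.numNodes + 3 * (B * numBranching B t) := by
  induction t with
  | nil => simp [pack, numTrue, numBranching]
  | node _ l r hl hr =>
    have h1 := fun c => Nat.mul_le_mul_left B (numTrue_setRoot_pack_le B l c)
    have h2 := fun c => Nat.mul_le_mul_left B (numTrue_setRoot_pack_le B r c)
    by_cases hb : IsHeavy B l ∧ IsHeavy B r
    · have h1 := h1 true
      have h2 := h2 true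
      simp only [pack, hb, numTrue, numBranching, BinaryTree.numNodes, mul_add, and_self,
        decide_true, Bool.or_true, Bool.true_or, if_true, Bool.toNat_true,
        Bool.toNat_false] at hl hr h1 h2 ⊢
      split_ifs at hl hr <;> omega
    · simp only [pack, hb, numTrue, numBranching, BinaryTree.numNodes, mul_add,
        decide_false, Bool.or_false, Bool.false_or, if_false, Bool.toNat_false,
        decide_eq_true_eq] at hl hr h1 h2 ⊢
      have h1 := h1 (pack B l).permanent
      have h2 := h2 (pack B r).permanent
      cases hpl : (pack B l).permanent <;> cases hpr : (pack B r).permanent <;>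
        simp only [hpl, hpr, Bool.toNat_true, Bool.toNat_false, if_true, if_false, mul_zero,
          mul_one, add_zero, Bool.false_eq_true] at hl hr h1 h2 ⊢ <;>
        split_ifs with h <;> simp [h] <;> omega

theorem mul_length_microShapes_le (B : ℕ) (t : BinaryTree Unit) :
    B * (microShapes B t).length ≤ 4 * t.numNodes + B := by
  have h1 := (microShapes_sublist B t).length_le.trans (length_extShapes_contract_le _)
  have h2 := h1.trans (numTrue_setRoot_pack_le B t true)
  have h3 := mul_numTrue_pack_le B t
  have h4 := mul_numBranching_le B t
  have h5 := Nat.mul_le_mul_left B h2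
  simp only [mul_add, Bool.toNat_true] at h3 h5
  omega

theorem numTrue_le_numNodes (τ : BinaryTree Bool) : numTrue τ ≤ τ.numNodes := by
  induction τ with
  | nil => simp [numTrue]
  | node c l r hl hr =>
    have := Bool.toNat_le c
    simp only [numTrue, BinaryTree.numNodes]
    omega

theorem map_setRoot (f : Bool → Unit) (c : Bool) (τ : BinaryTree Bool) :
    (setRoot c τ).map f = τ.map f := by
  cases τ <;> simp [setRoot, BinaryTree.map]

theorem map_pack_marks (f : Bool → Unit) (B : ℕ) (t : BinaryTree Unit) :
    (pack B t).marks.map f = t := by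
  induction t with
  | nil => simp [pack, BinaryTree.map]
  | node _ l r hl hr => simp only [pack, BinaryTree.map, map_setRoot, hl, hr]

theorem map_microRoots (f : Bool → Unit) (B : ℕ) (t : BinaryTree Unit) :
    (microRoots B t).map f = t := by
  rw [microRoots, map_setRoot, map_pack_marks]

theorem numNodes_map {α β : Type*} (f : α → β) (t : BinaryTree α) :
    (t.map f).numNodes = t.numNodes := by
  induction t with
  | nil => simp [BinaryTree.map]
  | node _ l r hl hr => simp [BinaryTree.map, hl, hr]

theorem length_microShapes_le (B : ℕ) (t : BinaryTree Unit) :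
    (microShapes B t).length ≤ t.numNodes := by
  have h := (microShapes_sublist B t).length_le.trans
    ((length_extShapes_contract_le _).trans (numTrue_le_numNodes _))
  rwa [← numNodes_map (fun _ => () : Bool → Unit), map_microRoots] at h

/-! ### Optimality of Huffman codes -/

/-- The number of `2 ^ (-M)`-units, all divisible by two, in a Kraft sum of lengths below `M`. -/
theorem exists_sum_map_half_pow (M : ℕ) (s : Multiset ℕ) (h : ∀ c ∈ s, c ≤ M) :
    ∃ k : ℕ, (s.map fun c => (1 / 2 : ℝ) ^ c).sum = k * (1 / 2 : ℝ) ^ M := by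
  induction s using Multiset.induction with
  | empty => exact ⟨0, by simp⟩
  | cons c s ih =>
    obtain ⟨k, hk⟩ := ih fun c hc => h c (Multiset.mem_cons_of_mem hc)
    have hc := h c (Multiset.mem_cons_self _ _)
    refine ⟨2 ^ (M - c) + k, ?_⟩
    obtain ⟨d, rfl⟩ := Nat.exists_eq_add_of_le hc
    simp only [Multiset.map_cons, Multiset.sum_cons, hk, Nat.add_sub_cancel_left]
    push_cast
    rw [add_mul, pow_add]
    have : (2 : ℝ) ^ d * (1 / 2) ^ d = 1 := by rw [← mul_pow]; norm_num
    linear_combination (-(1 / 2 : ℝ) ^ c) * this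

/-- A unique longest codeword can be shortened. -/
theorem kraft_trim (M : ℕ) (s : Multiset ℕ) (h : ∀ c ∈ s, c ≤ M)
    (hK : (1 / 2 : ℝ) ^ (M + 1) + (s.map fun c => (1 / 2 : ℝ) ^ c).sum ≤ 1) :
    (1 / 2 : ℝ) ^ M + (s.map fun c => (1 / 2 : ℝ) ^ c).sum ≤ 1 := by
  obtain ⟨k, hk⟩ := exists_sum_map_half_pow M s h
  rw [hk] at hK ⊢
  have hp : (2 : ℝ) ^ M * (1 / 2) ^ M = 1 := by rw [← mul_pow]; norm_num
  have h1 : (0 : ℝ) < (1 / 2) ^ M := by positivity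
  -- The other lengths contribute an integer multiple `k` of `2 ^ (-M)`. Room for half a unit
  -- therefore means room for a whole one.
  have h2 : (k : ℝ) < 2 ^ M := by
    by_contra hcon
    push Not at hcon
    have := mul_le_mul_of_nonneg_right hcon h1.le
    rw [pow_succ] at hK
    linarith
  have h3 : (k : ℝ) + 1 ≤ 2 ^ M := by exact_mod_cast (by exact_mod_cast h2 : k < 2 ^ M)
  have := mul_le_mul_of_nonneg_right h3 h1.le
  linarith

/-- The Kraft sum of an assignment of lengths. -/
noncomputable def kraftSum {β : Type*} (G : Multiset (β × ℕ)) : ℝ :=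
  (G.map fun g => (1 / 2 : ℝ) ^ g.2).sum

/-- The weighted length of an assignment of lengths. -/
def weightedLength {β : Type*} (w : β → ℕ) (G : Multiset (β × ℕ)) : ℕ :=
  (G.map fun g => w g.1 * g.2).sum

theorem kraftSum_eq {β : Type*} (G : Multiset (β × ℕ)) :
    kraftSum G = ((G.map Prod.snd).map fun c => (1 / 2 : ℝ) ^ c).sum := by
  simp [kraftSum, Multiset.map_map]

theorem kraftSum_nonneg {β : Type*} (G : Multiset (β × ℕ)) : 0 ≤ kraftSum G := by
  refine Multiset.sum_nonneg fun x hx => ?_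
  obtain ⟨g, -, rfl⟩ := Multiset.mem_map.1 hx
  positivity

/-- Two elements of smallest weight can be given equal lengths. -/
theorem exists_sibling_lengths {β : Type*} (w : β → ℕ) (x y : β) :
    ∀ N : ℕ, ∀ (a b : ℕ) (G : Multiset (β × ℕ)), a + b + 2 * (G.map Prod.snd).sum ≤ N →
      (∀ g ∈ G, w x ≤ w g.1 ∧ w y ≤ w g.1) →
      (1 / 2 : ℝ) ^ a + (1 / 2 : ℝ) ^ b + kraftSum G ≤ 1 →
      ∃ (c : ℕ) (G' : Multiset (β × ℕ)), G'.map Prod.fst = G.map Prod.fst ∧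
        (1 / 2 : ℝ) ^ c + kraftSum G' ≤ 1 ∧
        (w x + w y) * (c + 1) + weightedLength w G' ≤ w x * a + w y * b + weightedLength w G := by
  -- If the lengths `a`, `b` differ, say `a < b`, then either some other element has length above
  -- `a`, and swapping it with `x` does not increase the cost because `x` is lightest; or `b` is the
  -- unique longest length and can be shortened. The factor `2` in the induction measure makes it
  -- drop under a swap as well.
  intro N
  induction N with
  | zero =>
    intro a b G hN _ hK
    obtain ⟨rfl, rfl⟩ : a = 0 ∧ b = 0 := by omega
    have := kraftSum_nonneg G
    norm_num at hK
    linarith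
  | succ N ih =>
    intro a b G hN hw hK
    rcases lt_trichotomy a b with hab | rfl | hab
    · by_cases hG : ∃ g ∈ G, a < g.2
      · obtain ⟨⟨z, c⟩, hz, hc⟩ := hG
        obtain ⟨G, rfl⟩ := Multiset.exists_cons_of_mem hz
        simp only [kraftSum, weightedLength, Multiset.map_cons, Multiset.sum_cons] at *
        have hwz := hw _ (Multiset.mem_cons_self _ _)
        obtain ⟨d, G', h1, h2, h3⟩ := ih c b ((z, a) ::ₘ G)
          (by simp only [Multiset.map_cons, Multiset.sum_cons]; omega)
          (by
            intro g hg
            rcases Multiset.mem_cons.1 hg with rfl | hg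
            · exact hwz
            · exact hw g (Multiset.mem_cons_of_mem hg))
          (by simp only [Multiset.map_cons, Multiset.sum_cons]; linarith)
        refine ⟨d, G', by simpa using h1, h2, h3.trans ?_⟩
        simp only [Multiset.map_cons, Multiset.sum_cons]
        obtain ⟨e, rfl⟩ := Nat.exists_eq_add_of_lt hc
        have := Nat.mul_le_mul_right (e + 1) hwz.1
        simp only at this
        nlinarith
      · push Not at hG
        obtain ⟨M, rfl⟩ : ∃ M, b = M + 1 := ⟨b - 1, by omega⟩
        have hK' := kraft_trim M (a ::ₘ G.map Prod.snd)
          (by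
            intro c hc
            rcases Multiset.mem_cons.1 hc with rfl | hc
            · omega
            · obtain ⟨g, hg, rfl⟩ := Multiset.mem_map.1 hc
              have := hG g hg
              omega)
          (by rw [Multiset.map_cons, Multiset.sum_cons, ← kraftSum_eq]; linarith)
        rw [Multiset.map_cons, Multiset.sum_cons, ← kraftSum_eq] at hK'
        obtain ⟨d, G', h1, h2, h3⟩ := ih a M G (by omega) hw (by linarith)
        exact ⟨d, G', h1, h2, h3.trans (by nlinarith)⟩
    -- Equal lengths `c + 1` merge into one element of length `c`. Length `0` is excluded, since two
    -- such elements already have Kraft sum `2`.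
    · cases a with
      | zero =>
        have := kraftSum_nonneg G
        norm_num at hK
        linarith
      | succ c =>
        refine ⟨c, G, rfl, ?_, by rw [add_mul]⟩
        rw [pow_succ] at hK
        linarith
    · by_cases hG : ∃ g ∈ G, b < g.2
      · obtain ⟨⟨z, c⟩, hz, hc⟩ := hG
        obtain ⟨G, rfl⟩ := Multiset.exists_cons_of_mem hz
        simp only [kraftSum, weightedLength, Multiset.map_cons, Multiset.sum_cons] at *
        have hwz := hw _ (Multiset.mem_cons_self _ _)
        obtain ⟨d, G', h1, h2, h3⟩ := ih a c ((z, b) ::ₘ G)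
          (by simp only [Multiset.map_cons, Multiset.sum_cons]; omega)
          (by
            intro g hg
            rcases Multiset.mem_cons.1 hg with rfl | hg
            · exact hwz
            · exact hw g (Multiset.mem_cons_of_mem hg))
          (by simp only [Multiset.map_cons, Multiset.sum_cons]; linarith)
        refine ⟨d, G', by simpa using h1, h2, h3.trans ?_⟩
        simp only [Multiset.map_cons, Multiset.sum_cons]
        obtain ⟨e, rfl⟩ := Nat.exists_eq_add_of_lt hc
        have := Nat.mul_le_mul_right (e + 1) hwz.2
        simp only at this
        nlinarith
      · push Not at hG
        obtain ⟨M, rfl⟩ : ∃ M, a = M + 1 := ⟨a - 1, by omega⟩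
        have hK' := kraft_trim M (b ::ₘ G.map Prod.snd)
          (by
            intro c hc
            rcases Multiset.mem_cons.1 hc with rfl | hc
            · omega
            · obtain ⟨g, hg, rfl⟩ := Multiset.mem_map.1 hc
              have := hG g hg
              omega)
          (by rw [Multiset.map_cons, Multiset.sum_cons, ← kraftSum_eq]; linarith)
        rw [Multiset.map_cons, Multiset.sum_cons, ← kraftSum_eq] at hK'
        obtain ⟨d, G', h1, h2, h3⟩ := ih M b G (by omega) hw (by linarith)
        exact ⟨d, G', h1, h2, h3.trans (by nlinarith)⟩

/-- Total weight of the leaves of a code tree. -/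
def CodeTree.weight {α : Type*} (f : α → ℕ) : CodeTree α → ℕ
  | .leaf a => f a
  | .node l r => l.weight f + r.weight f

/-- Weighted external path length of a code tree. -/
def CodeTree.cost {α : Type*} (f : α → ℕ) : CodeTree α → ℕ
  | .leaf _ => 0
  | .node l r => l.cost f + r.cost f + l.weight f + r.weight f

theorem CodeTree.sum_codes_weight {α : Type*} (f : α → ℕ) (T : CodeTree α) :
    (T.codes.map fun x => f x.1).sum = T.weight f := by
  induction T with
  | leaf a => simp [codes, weight]
  | node l r hl hr => simp [codes, weight, ← hl, ← hr, Function.comp_def]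

theorem CodeTree.sum_codes_cost {α : Type*} (f : α → ℕ) (T : CodeTree α) :
    (T.codes.map fun x => f x.1 * x.2.length).sum = T.cost f := by
  induction T with
  | leaf a => simp [codes, cost]
  | node l r hl hr =>
    simp only [codes, cost, List.map_append, List.map_map, List.sum_append, Function.comp_def,
      List.length_cons, mul_add, mul_one, List.sum_map_add, hl, hr, sum_codes_weight]
    omega

/-- Induction along the run, with the competing lengths given to the trees of the current forest.
`exists_sibling_lengths` turns the two merged trees into siblings of length `c + 1`; giving length
`c` to the merged tree saves their total weight, which is what the merge adds to the cost. -/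
theorem HuffmanRun.cost_le {α : Type*} (f : α → ℕ) {F : Multiset (ℕ × CodeTree α)}
    {T : CodeTree α} (h : HuffmanRun F T) (hF : ∀ x ∈ F, x.1 = x.2.weight f)
    (G : Multiset ((ℕ × CodeTree α) × ℕ)) (hG : G.map Prod.fst = F) (hK : kraftSum G ≤ 1) :
    T.cost f ≤ (F.map fun x => x.2.cost f).sum + weightedLength Prod.fst G := by
  classical
  induction h generalizing G with
  | single w T => simp
  | merge x y F T hmin h ih =>
    obtain ⟨⟨x', a⟩, hx, hx1, hG1⟩ := (Multiset.map_eq_cons _ _ _ _).2 hG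
    obtain ⟨⟨y', b⟩, hy, hy1, hG2⟩ := (Multiset.map_eq_cons _ _ _ _).2 hG1
    simp only at hx1 hy1
    subst hx1 hy1
    generalize hG' : (G.erase (x', a)).erase (y', b) = G' at hG2
    have hGG : G = (x', a) ::ₘ (y', b) ::ₘ G' := by
      rw [← hG', Multiset.cons_erase hy, Multiset.cons_erase hx]
    subst hGG
    clear hG hG1 hG' hx hy
    obtain ⟨c, G'', h1, h2, h3⟩ := exists_sibling_lengths Prod.fst x' y' _ a b G' le_rfl
      (fun g hg => hmin _ (hG2 ▸ Multiset.mem_map_of_mem _ hg))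
      (by simpa [kraftSum, add_assoc] using hK)
    have hwx := hF x' (by simp)
    have hwy := hF y' (by simp)
    have := ih
      (by
        intro z hz
        rcases Multiset.mem_cons.1 hz with rfl | hz
        · simp [CodeTree.weight, hwx, hwy]
        · exact hF z (by simp [hz]))
      ((((x'.1 + y'.1, CodeTree.node x'.2 y'.2) : ℕ × CodeTree α), c) ::ₘ G'')
      (by simp [h1, hG2]) (by simpa [kraftSum] using h2)
    simp only [weightedLength, Multiset.map_cons, Multiset.sum_cons, CodeTree.cost, ← hwx,
      ← hwy] at this h3 ⊢
    nlinarith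

/-- A Huffman code is at least as good as every assignment of lengths that satisfies the Kraft
inequality. -/
theorem IsHuffmanCode.sum_length_le {α : Type*} [DecidableEq α] {s : List α} {C : α → List Bool}
    (h : IsHuffmanCode s C) (len : α → ℕ)
    (hK : ∑ a ∈ s.toFinset, (1 / 2 : ℝ) ^ len a ≤ 1) :
    (s.map fun a => (C a).length).sum ≤ (s.map len).sum := by
  by_cases hs : s = []
  · simp [hs]
  obtain ⟨T, hT, hC⟩ := h hs
  rw [Finset.sum_list_map_count, Finset.sum_list_map_count]
  have hC : ∀ a ∈ s.toFinset, (a, C a) ∈ T.codes := fun a ha => hC a (List.mem_toFinset.1 ha)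
  rw [huffmanForest] at hT
  generalize s.toFinset = S at hK hT hC ⊢
  have hcost := hT.cost_le (fun a => s.count a)
    (by
      intro x hx
      obtain ⟨a, -, rfl⟩ := Multiset.mem_map.1 hx
      rfl)
    (S.val.map fun a => ((s.count a, CodeTree.leaf a), len a))
    (by simp only [Multiset.map_map, Function.comp_def])
    (by rw [kraftSum, Multiset.map_map]; exact hK)
  simp only [weightedLength, Multiset.map_map, Function.comp_def, CodeTree.cost,
    Multiset.map_const', Multiset.sum_replicate, smul_zero, zero_add] at hcost
  refine le_trans ?_ hcost
  rw [← CodeTree.sum_codes_cost]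
  -- Inclusion suffices: any further entries of `T.codes` contribute nonnegative terms to the cost.
  have hsub : (S.val.map fun a => (a, C a)) ≤ (T.codes : Multiset (α × List Bool)) := by
    rw [Multiset.le_iff_subset (S.nodup.map fun a b hab => (Prod.mk.inj hab).1)]
    intro x hx
    obtain ⟨a, ha, rfl⟩ := Multiset.mem_map.1 hx
    exact hC a ha
  obtain ⟨u, hu⟩ := Multiset.le_iff_exists_add.1
    (Multiset.map_le_map (f := fun x : α × List Bool => s.count x.1 * x.2.length) hsub)
  have hu := congrArg Multiset.sum hu
  simp only [Multiset.sum_add, Multiset.map_map, Function.comp_def, Multiset.map_coe,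
    Multiset.sum_coe] at hu
  rw [hu]
  exact Nat.le_add_right _ _

/-! ### Sources given by a recursively defined measure of trees -/

/-- The measure of a binary tree in which a node adds one to the combination `G` of the measures
of its subtrees. -/
def foldSize (G : ℕ → ℕ → ℕ) : BinaryTree Unit → ℕ
  | .nil => 0
  | .node _ l r => G (foldSize G l) (foldSize G r) + 1

/-- Probability of a tree under the source `p` with respect to the measure `foldSize G`. -/
noncomputable def treeProb (G : ℕ → ℕ → ℕ) (p : ℕ → ℕ → ℝ) : BinaryTree Unit → ℝ
  | .nil => 1
  | .node _ l r => p (foldSize G l) (foldSize G r) * (treeProb G p l * treeProb G p r)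

/-- The properties shared by `(· + ·)` and `max`. -/
structure IsSizeRule (G : ℕ → ℕ → ℕ) : Prop where
  mono : ∀ {i i' j j'}, i ≤ i' → j ≤ j' → G i j ≤ G i' j'
  left_le : ∀ i j, i ≤ G i j
  right_le : ∀ i j, j ≤ G i j
  le_add : ∀ i j, G i j ≤ i + j

/-- `p` is a source with respect to the measure `foldSize G`. -/
structure IsSource (G : ℕ → ℕ → ℕ) (p : ℕ → ℕ → ℝ) : Prop where
  nonneg : ∀ l r, 0 ≤ p l r
  le_one : ∀ l r, p l r ≤ 1
  sum_eq_one : ∀ k : ℕ,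
    ∑ ij ∈ (Finset.range (k + 1) ×ˢ Finset.range (k + 1)).filter (fun ij => G ij.1 ij.2 = k),
      p ij.1 ij.2 = 1

theorem isSizeRule_add : IsSizeRule (· + ·) where
  mono h h' := Nat.add_le_add h h'
  left_le := Nat.le_add_right
  right_le i j := Nat.le_add_left j i
  le_add _ _ := le_rfl

theorem isSizeRule_max : IsSizeRule max where
  mono := max_le_max
  left_le := le_max_left
  right_le := le_max_right
  le_add i j := by omega

theorem foldSize_add (t : BinaryTree Unit) : foldSize (· + ·) t = t.numNodes := by
  induction t with
  | nil => rfl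
  | node _ l r hl hr => simp [foldSize, hl, hr]

theorem foldSize_max (t : BinaryTree Unit) : foldSize max t = t.height := by
  induction t with
  | nil => rfl
  | node _ l r hl hr => simp [foldSize, hl, hr]

theorem treeProb_add (p : ℕ → ℕ → ℝ) : treeProb (· + ·) p = fixedSizeProb p := by
  funext t
  induction t with
  | nil => rfl
  | node _ l r hl hr => rw [treeProb, fixedSizeProb, hl, hr, foldSize_add, foldSize_add]

theorem treeProb_max (p : ℕ → ℕ → ℝ) : treeProb max p = fixedHeightProb p := by
  funext t
  induction t with
  | nil => rfl
  | node _ l r hl hr => rw [treeProb, fixedHeightProb, hl, hr, foldSize_max, foldSize_max]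

theorem IsFixedSizeSource.isSource {p : ℕ → ℕ → ℝ} (h : IsFixedSizeSource p) :
    IsSource (· + ·) p where
  nonneg := h.nonneg
  le_one := h.le_one
  sum_eq_one k := by
    rw [← h.sum_eq_one k, ← Finset.Nat.sum_antidiagonal_eq_sum_range_succ p]
    refine Finset.sum_congr ?_ fun _ _ => rfl
    ext ⟨i, j⟩
    simp only [Finset.mem_filter, Finset.mem_product, Finset.mem_range,
      Finset.HasAntidiagonal.mem_antidiagonal]
    omega

theorem IsFixedHeightSource.isSource {p : ℕ → ℕ → ℝ} (h : IsFixedHeightSource p) :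
    IsSource max p :=
  ⟨h.nonneg, h.le_one, h.sum_eq_one⟩

section

variable {G : ℕ → ℕ → ℕ} {p : ℕ → ℕ → ℝ}

theorem IsSizeRule.foldSize_le_numNodes (hG : IsSizeRule G) (t : BinaryTree Unit) :
    foldSize G t ≤ t.numNodes := by
  induction t with
  | nil => exact le_rfl
  | node _ l r hl hr =>
    have := hG.le_add (foldSize G l) (foldSize G r)
    simp only [foldSize, BinaryTree.numNodes]
    omega

theorem IsSource.treeProb_nonneg (hp : IsSource G p) (t : BinaryTree Unit) :
    0 ≤ treeProb G p t := by
  induction t with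
  | nil => exact zero_le_one
  | node _ l r hl hr => exact mul_nonneg (hp.nonneg _ _) (mul_nonneg hl hr)

theorem IsSource.treeProb_le_one (hp : IsSource G p) (t : BinaryTree Unit) :
    treeProb G p t ≤ 1 := by
  induction t with
  | nil => exact le_rfl
  | node _ l r hl hr =>
    exact mul_le_one₀ (hp.le_one _ _) (mul_nonneg (hp.treeProb_nonneg l) (hp.treeProb_nonneg r))
      (mul_le_one₀ hl (hp.treeProb_nonneg r) hr)

/-- The trees of a given measure have total probability at most one. -/
theorem IsSource.sum_treeProb_le_one (hG : IsSizeRule G) (hp : IsSource G p) (k : ℕ) :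
    ∀ S : Finset (BinaryTree Unit), (∀ t ∈ S, foldSize G t = k) →
      ∑ t ∈ S, treeProb G p t ≤ 1 := by
  induction k using Nat.strong_induction_on with
  | _ k ih =>
  intro S hS
  cases k with
  | zero =>
    have : S ⊆ {.nil} := by
      intro t ht
      have := hS t ht
      cases t with
      | nil => simp
      | node _ l r => simp [foldSize] at this
    refine (Finset.sum_le_sum_of_subset_of_nonneg this fun t _ _ => hp.treeProb_nonneg t).trans ?_
    simp [treeProb]
  | succ k =>
    -- The trees are sorted by the measures `(i, j)` of their two subtrees. Both are at most `k`, so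
    -- the induction hypothesis bounds the left and the right subtrees separately, and each class
    -- has mass at most `p i j`.
    set I := (Finset.range (k + 1) ×ˢ Finset.range (k + 1)).filter fun ij => G ij.1 ij.2 = k
      with hI
    set f : BinaryTree Unit → ℕ × ℕ := fun t => (foldSize G t.left, foldSize G t.right) with hf
    have hmaps : ∀ t ∈ S, f t ∈ I := by
      intro t ht
      have h := hS t ht
      cases t with
      | nil => simp [foldSize] at h
      | node _ l r =>
        simp only [foldSize, Nat.add_right_cancel_iff] at h
        have h1 := hG.left_le (foldSize G l) (foldSize G r)
        have h2 := hG.right_le (foldSize G l) (foldSize G r)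
        simp only [hI, hf, BinaryTree.left, BinaryTree.right, Finset.mem_filter,
          Finset.mem_product, Finset.mem_range]
        omega
    rw [← Finset.sum_fiberwise_of_maps_to hmaps, ← hp.sum_eq_one k]
    refine Finset.sum_le_sum fun ij hij => ?_
    obtain ⟨i, j⟩ := ij
    simp only [hI, Finset.mem_filter, Finset.mem_product, Finset.mem_range] at hij
    set T := S.filter fun t => f t = (i, j) with hT
    have hmem : ∀ t ∈ T, t ≠ .nil ∧ foldSize G t.left = i ∧ foldSize G t.right = j := by
      intro t ht
      obtain ⟨h1, h2⟩ := Finset.mem_filter.1 ht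
      refine ⟨?_, congrArg Prod.fst h2, congrArg Prod.snd h2⟩
      rintro rfl
      simpa [foldSize] using hS _ h1
    have hL := ih i (by omega) (T.image BinaryTree.left) (by
      intro l hl
      obtain ⟨t, ht, rfl⟩ := Finset.mem_image.1 hl
      exact (hmem t ht).2.1)
    have hR := ih j (by omega) (T.image BinaryTree.right) (by
      intro l hl
      obtain ⟨t, ht, rfl⟩ := Finset.mem_image.1 hl
      exact (hmem t ht).2.2)
    have hprob : ∀ t ∈ T, treeProb G p t =
        p i j * (treeProb G p t.left * treeProb G p t.right) := by
      intro t ht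
      obtain ⟨h0, h1, h2⟩ := hmem t ht
      cases t with
      | nil => exact absurd rfl h0
      | node _ l r => rw [← h1, ← h2]; rfl
    have hinj : Set.InjOn (fun t : BinaryTree Unit => (t.left, t.right)) T := by
      intro t ht u hu h
      have ht := (hmem t ht).1
      have hu := (hmem u hu).1
      rw [← BinaryTree.left_node_right_eq_self ht, ← BinaryTree.left_node_right_eq_self hu]
      rw [(Prod.mk.inj h).1, (Prod.mk.inj h).2]
    have hsum : ∑ t ∈ T, treeProb G p t.left * treeProb G p t.right ≤ 1 := by
      rw [← Finset.sum_image (f := fun lr : BinaryTree Unit × BinaryTree Unit =>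
        treeProb G p lr.1 * treeProb G p lr.2) hinj]
      -- Enlarging the set of pairs to a full product makes the sum factor.
      have hsub : T.image (fun t : BinaryTree Unit => (t.left, t.right)) ⊆
          T.image BinaryTree.left ×ˢ T.image BinaryTree.right := by
        intro x hx
        obtain ⟨t, ht, rfl⟩ := Finset.mem_image.1 hx
        exact Finset.mem_product.2 ⟨Finset.mem_image_of_mem _ ht, Finset.mem_image_of_mem _ ht⟩
      refine (Finset.sum_le_sum_of_subset_of_nonneg hsub fun x _ _ =>
        mul_nonneg (hp.treeProb_nonneg _) (hp.treeProb_nonneg _)).trans ?_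
      rw [Finset.sum_product, ← Finset.sum_mul_sum]
      exact mul_le_one₀ hL (Finset.sum_nonneg fun t _ => hp.treeProb_nonneg t) hR
    rw [Finset.sum_congr rfl hprob, ← Finset.mul_sum]
    exact mul_le_of_le_one_right (hp.nonneg _ _) hsum

/-- The trees with at most `K` nodes have total probability at most `K + 1`. -/
theorem IsSource.sum_treeProb_le (hG : IsSizeRule G) (hp : IsSource G p) (K : ℕ)
    (S : Finset (BinaryTree Unit)) (hS : ∀ t ∈ S, t.numNodes ≤ K) :
    ∑ t ∈ S, treeProb G p t ≤ K + 1 := by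
  -- The measure never exceeds the number of nodes, so it takes at most `K + 1` values, each with
  -- mass at most one.
  rw [← Finset.sum_fiberwise_of_maps_to (s := S) (t := Finset.range (K + 1)) (g := foldSize G)]
  · refine (Finset.sum_le_card_nsmul _ _ 1 fun k _ =>
      hp.sum_treeProb_le_one hG k _ fun t ht => (Finset.mem_filter.1 ht).2).trans ?_
    simp
  · intro t ht
    exact Finset.mem_range_succ_iff.2 ((hG.foldSize_le_numNodes t).trans (hS t ht))

/-! ### Submultiplicativity over the micro trees -/

theorem IsMonotonic.anti {p : ℕ → ℕ → ℝ} (h : IsMonotonic p) {i i' j j' : ℕ} (hi : i ≤ i')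
    (hj : j ≤ j') : p i' j' ≤ p i j :=
  (antitone_nat_of_succ_le (f := fun i => p i j') (fun l => (h l j').1) hi).trans
    (antitone_nat_of_succ_le (f := fun j => p i j) (fun r => (h i r).2) hj)

theorem IsSizeRule.foldSize_contract_le (hG : IsSizeRule G) (τ : BinaryTree Bool) :
    foldSize G (contract τ).1 ≤ foldSize G (τ.map fun _ => ()) := by
  induction τ with
  | nil => exact le_rfl
  | node c l r hl hr =>
    cases c with
    | true => rw [contract_node_true_fst]; exact Nat.zero_le _
    | false =>
      rw [contract_node_false_fst]
      exact Nat.succ_le_succ (hG.mono hl hr)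

theorem IsSource.prod_treeProb_le_of_sublist (hp : IsSource G p) {s s' : List (BinaryTree Unit)}
    (h : s.Sublist s') :
    (s'.map (treeProb G p)).prod ≤ (s.map (treeProb G p)).prod := by
  have hnn : ∀ s : List (BinaryTree Unit), 0 ≤ (s.map (treeProb G p)).prod := by
    intro s
    refine List.prod_nonneg fun x hx => ?_
    obtain ⟨t, -, rfl⟩ := List.mem_map.1 hx
    exact hp.treeProb_nonneg t
  induction h with
  | slnil => exact le_rfl
  | cons a h ih =>
    rw [List.map_cons, List.prod_cons]
    exact (mul_le_of_le_one_left (hnn _) (hp.treeProb_le_one a)).trans ih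
  | cons_cons a h ih =>
    rw [List.map_cons, List.prod_cons, List.map_cons, List.prod_cons]
    exact mul_le_mul_of_nonneg_left ih (hp.treeProb_nonneg a)

/-- Contracting the subtrees of a node does not increase their measures, so by monotonicity its
factor `p` does not decrease. The unfinished component has its own factor, which makes the bound
inductive for every labelling; at a marked root this factor moves into the product over the pieces.
-/
theorem IsSource.treeProb_le_contract (hG : IsSizeRule G) (hp : IsSource G p)
    (hm : IsMonotonic p) (τ : BinaryTree Bool) :
    treeProb G p (τ.map fun _ => ()) ≤
      treeProb G p (contract τ).1 * ((extShapes (contract τ).2).map (treeProb G p)).prod := by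
  induction τ with
  | nil => simp [BinaryTree.map, contract, extShapes]
  | node c l r hl hr =>
    have key : treeProb G p ((BinaryTree.node c l r).map fun _ => ()) ≤
        ((BinaryTree.node () (contract l).1 (contract r).1 ::
          (extShapes (contract l).2 ++ extShapes (contract r).2)).map (treeProb G p)).prod := by
      have h1 := hm.anti (hG.foldSize_contract_le l) (hG.foldSize_contract_le r)
      have h2 := mul_le_mul hl hr (hp.treeProb_nonneg _) ((hp.treeProb_nonneg _).trans hl)
      have h3 := mul_le_mul h1 h2 (mul_nonneg (hp.treeProb_nonneg _) (hp.treeProb_nonneg _))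
        (hp.nonneg _ _)
      simp only [List.map_cons, List.prod_cons, List.map_append, List.prod_append, treeProb,
        BinaryTree.map]
      exact h3.trans (le_of_eq (by ring))
    cases c with
    | false =>
      rw [contract_node_false_fst, extShapes_contract_node_false]
      simpa using key
    | true =>
      rw [contract_node_true_fst, treeProb, one_mul]
      exact key.trans (hp.prod_treeProb_le_of_sublist (extShapes_contract_node_true_sublist l r))

theorem IsSource.treeProb_le_prod_microShapes (hG : IsSizeRule G) (hp : IsSource G p)
    (hm : IsMonotonic p) (B : ℕ) (t : BinaryTree Unit) :
    treeProb G p t ≤ ((microShapes B t).map (treeProb G p)).prod := by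
  have h := hp.treeProb_le_contract hG hm (microRoots B t)
  have h1 : (contract (microRoots B t)).1 = .nil := by
    rw [microRoots, contract_setRoot_pack_fst, if_pos rfl]
  rw [map_microRoots, h1, treeProb, one_mul] at h
  exact h.trans (hp.prod_treeProb_le_of_sublist (microShapes_sublist B t))

end

/-! ### Random binary search trees and uniform random trees -/

theorem isFixedSizeSource_bstSource : IsFixedSizeSource bstSource where
  nonneg l r := by unfold bstSource; positivity
  le_one l r := by
    unfold bstSource
    rw [div_le_one (by positivity)]
    have : (0 : ℝ) ≤ l := Nat.cast_nonneg l
    have : (0 : ℝ) ≤ r := Nat.cast_nonneg r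
    linarith
  sum_eq_one n := by
    have h : ∀ l ∈ Finset.range (n + 1), bstSource l (n - l) = 1 / ((n : ℝ) + 1) := by
      intro l hl
      rw [bstSource, Nat.cast_sub (Finset.mem_range_succ_iff.1 hl), add_sub_cancel]
    rw [Finset.sum_congr rfl h, Finset.sum_const, Finset.card_range, nsmul_eq_mul]
    push_cast
    field_simp

theorem isMonotonic_bstSource : IsMonotonic bstSource := by
  intro l r
  unfold bstSource
  constructor <;> refine one_div_le_one_div_of_le (by positivity) ?_ <;> push_cast <;> linarith

theorem uniformSource_eq (l r : ℕ) :
    uniformSource l r = (catalan l : ℝ) * catalan r / catalan (l + r + 1) := by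
  simp only [uniformSource, BinaryTree.treesOfNumNodesEq_card_eq_catalan]

theorem catalan_pos (n : ℕ) : 0 < catalan n := by
  have h := succ_mul_catalan_eq_centralBinom n
  have := Nat.centralBinom_pos n
  rw [← h] at this
  exact Nat.pos_of_mul_pos_left this

theorem add_two_mul_catalan_succ (n : ℕ) :
    (n + 2) * catalan (n + 1) = 2 * (2 * n + 1) * catalan n := by
  have h1 := succ_mul_catalan_eq_centralBinom (n + 1)
  have h2 := Nat.succ_mul_centralBinom_succ n
  rw [← h1, ← succ_mul_catalan_eq_centralBinom n] at h2
  refine Nat.eq_of_mul_eq_mul_left (Nat.succ_pos n) ?_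
  linarith

/-- The ratio of consecutive Catalan numbers increases. -/
theorem catalan_succ_mul_le (l d : ℕ) :
    catalan (l + 1) * catalan (l + d) ≤ catalan l * catalan (l + d + 1) := by
  have h1 := add_two_mul_catalan_succ l
  have h2 := add_two_mul_catalan_succ (l + d)
  -- The ratio of consecutive Catalan numbers is `2 (2n + 1) / (n + 2)`; after clearing denominators
  -- the two sides differ by `6 d`.
  have h3 : (l + d + 2) * (2 * (2 * l + 1)) ≤ (l + 2) * (2 * (2 * (l + d) + 1)) := by
    nlinarith
  refine Nat.le_of_mul_le_mul_left (c := (l + 2) * (l + d + 2)) ?_ (by positivity)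
  calc (l + 2) * (l + d + 2) * (catalan (l + 1) * catalan (l + d))
      = (l + d + 2) * ((l + 2) * catalan (l + 1)) * catalan (l + d) := by ring
    _ = (l + d + 2) * (2 * (2 * l + 1)) * (catalan l * catalan (l + d)) := by rw [h1]; ring
    _ ≤ (l + 2) * (2 * (2 * (l + d) + 1)) * (catalan l * catalan (l + d)) :=
        Nat.mul_le_mul_right _ h3
    _ = (l + 2) * catalan l * ((l + d + 2) * catalan (l + d + 1)) := by rw [h2]; ring
    _ = (l + 2) * (l + d + 2) * (catalan l * catalan (l + d + 1)) := by ring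

theorem isFixedSizeSource_uniformSource : IsFixedSizeSource uniformSource := by
  have hnn : ∀ l r, 0 ≤ uniformSource l r := fun l r => by unfold uniformSource; positivity
  have hsum : ∀ n, ∑ l ∈ Finset.range (n + 1), uniformSource l (n - l) = 1 := by
    intro n
    have h : ∀ l ∈ Finset.range (n + 1), uniformSource l (n - l) =
        (catalan l : ℝ) * catalan (n - l) / catalan (n + 1) := by
      intro l hl
      rw [uniformSource_eq, Nat.add_sub_cancel' (Finset.mem_range_succ_iff.1 hl)]
    have hc := catalan_succ' n
    rw [Finset.Nat.sum_antidiagonal_eq_sum_range_succ fun i j => catalan i * catalan j] at hc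
    rw [Finset.sum_congr rfl h, ← Finset.sum_div, div_eq_one_iff_eq
      (Nat.cast_ne_zero.2 (catalan_pos _).ne'), hc]
    push_cast
    rfl
  refine ⟨hnn, fun l r => ?_, hsum⟩
  -- Each value is one of the nonnegative terms of a sum equal to one.
  rw [← hsum (l + r)]
  have := Finset.single_le_sum (f := fun i => uniformSource i (l + r - i))
    (fun i _ => hnn i _) (Finset.mem_range.2 (by omega : l < l + r + 1))
  simpa using this

theorem isMonotonic_uniformSource : IsMonotonic uniformSource := by
  have key : ∀ l r, uniformSource (l + 1) r ≤ uniformSource l r := by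
    intro l r
    -- The factor `catalan r` is common to both sides, so only the ratios of consecutive Catalan
    -- numbers at `l` and at `l + r + 1` are compared.
    have h : (catalan (l + 1) : ℝ) * catalan (l + r + 1) ≤ catalan l * catalan (l + r + 2) := by
      exact_mod_cast catalan_succ_mul_le l (r + 1)
    have h1 : (0 : ℝ) < catalan (l + r + 1) := Nat.cast_pos.2 (catalan_pos _)
    have h2 : (0 : ℝ) < catalan (l + r + 2) := Nat.cast_pos.2 (catalan_pos _)
    rw [uniformSource_eq, uniformSource_eq, show l + 1 + r + 1 = l + r + 2 by ring,
      div_le_div_iff₀ h2 h1]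
    have := mul_le_mul_of_nonneg_right h (Nat.cast_nonneg (α := ℝ) (catalan r))
    linarith
  have symm : ∀ l r, uniformSource l r = uniformSource r l := by
    intro l r
    rw [uniformSource_eq, uniformSource_eq, mul_comm, add_comm l r]
  intro l r
  exact ⟨key l r, by rw [symm l, symm l]; exact key r l⟩

/-- The product telescopes: the Catalan numbers in the numerator of a node cancel against the
probabilities of its subtrees. -/
theorem fixedSizeProb_uniformSource (t : BinaryTree Unit) :
    fixedSizeProb uniformSource t = 1 / (catalan t.numNodes : ℝ) := by
  induction t with
  | nil => simp [fixedSizeProb]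
  | node _ l r hl hr =>
    have h1 : (catalan l.numNodes : ℝ) ≠ 0 := Nat.cast_ne_zero.2 (catalan_pos _).ne'
    have h2 : (catalan r.numNodes : ℝ) ≠ 0 := Nat.cast_ne_zero.2 (catalan_pos _).ne'
    rw [fixedSizeProb, hl, hr, uniformSource_eq, BinaryTree.numNodes]
    field_simp

/-! ### The length of the hypersuccinct code -/

theorem length_fixedWidth (w k : ℕ) : (fixedWidth w k).length = w := by
  simp [fixedWidth]

theorem length_eliasGamma (k : ℕ) : (eliasGamma k).length = 2 * Nat.log 2 k + 1 := by
  simp [eliasGamma, length_fixedWidth]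
  ring

theorem length_eliasGamma_le (k : ℕ) : (eliasGamma k).length ≤ 2 * k + 1 := by
  rw [length_eliasGamma]
  have := Nat.log_le_self 2 k
  omega

theorem length_bp {α : Type*} (t : BinaryTree α) : (bp t).length = 2 * t.numNodes := by
  induction t with
  | nil => rfl
  | node _ l r hl hr => simp [bp, hl, hr]; ring

theorem length_preorder {α : Type*} (t : BinaryTree α) : (preorder t).length = t.numNodes := by
  induction t with
  | nil => rfl
  | node _ l r hl hr => simp [preorder, hl, hr]

/-- The escape word has length `2|s| + 2⌊lg(|s|+1)⌋ + 2` and replaces only codewords longer than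
`2|s| + 2⌊lg(|s|+1)⌋`. -/
theorem length_lengthRestrict_le_succ (C : BinaryTree Unit → List Bool) (s : BinaryTree Unit) :
    (lengthRestrict C s).length ≤ (C s).length + 1 := by
  unfold lengthRestrict
  split_ifs with h
  · simp only [List.length_cons, List.length_append, length_eliasGamma, length_bp]
    omega
  · simp

theorem length_lengthRestrict_le (C : BinaryTree Unit → List Bool) (s : BinaryTree Unit) :
    (lengthRestrict C s).length ≤ 4 * s.numNodes + 4 := by
  have := Nat.log_le_self 2 (s.numNodes + 1)
  unfold lengthRestrict
  split_ifs with h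
  · simp only [List.length_cons, List.length_append, length_eliasGamma, length_bp]
    omega
  · simp only [List.length_cons]
    omega

/-- A table entry has at most `(8K + 9) + (4K + 4) + (2K + 1) + 2K = 16K + 14` bits; the gamma code
of the alphabet size adds at most two more per shape, plus one bit. Each micro tree pays two bits of
`bp Υ`, one flag bit and two portals. The `3` collects the final bits of three gamma codes. -/
theorem length_codeWord_le (n w K : ℕ) (C : BinaryTree Unit → List Bool)
    (Υ : BinaryTree MicroTree) (s : List (BinaryTree Unit))
    (hs : s = (preorder Υ).map MicroTree.shape) (hK : ∀ σ ∈ s, σ.numNodes ≤ K) :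
    (codeWord n w C Υ).length ≤ 2 * Nat.log 2 (n + 1) + 2 * Nat.log 2 (s.length + 1) + 3 +
      s.toFinset.card * (16 * K + 16) + s.length * (3 + 2 * w) +
      (s.map fun σ => (C σ).length).sum := by
  have hm : s.length = (preorder Υ).length := by rw [hs, List.length_map]
  have hΥ : Υ.numNodes = s.length := by rw [hm, length_preorder]
  have htable : ((s.dedup.flatMap fun σ =>
      eliasGamma (lengthRestrict C σ).length ++ lengthRestrict C σ ++
        eliasGamma σ.numNodes ++ bp σ)).length ≤ s.toFinset.card * (16 * K + 14) := by
    rw [List.length_flatMap, List.card_toFinset]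
    refine (List.sum_le_card_nsmul _ (16 * K + 14) fun x hx => ?_).trans (by simp)
    obtain ⟨σ, hσ, rfl⟩ := List.mem_map.1 hx
    have h1 := hK σ (List.mem_dedup.1 hσ)
    have h2 := length_lengthRestrict_le C σ
    have h3 := length_eliasGamma_le (lengthRestrict C σ).length
    have h4 := length_eliasGamma_le σ.numNodes
    simp only [List.length_append, length_bp]
    omega
  have hcodes : (s.flatMap (lengthRestrict C)).length ≤
      (s.map fun σ => (C σ).length).sum + s.length := by
    rw [List.length_flatMap]
    clear hs hK hm hΥ htable
    induction s with
    | nil => simp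
    | cons σ s ih =>
      have := length_lengthRestrict_le_succ C σ
      simp only [List.map_cons, List.sum_cons, List.length_cons]
      omega
  have hportals : ((preorder Υ).flatMap fun m =>
      fixedWidth w m.leftPortal ++ fixedWidth w m.rightPortal).length = s.length * (2 * w) := by
    rw [hm, List.length_flatMap]
    simp [length_fixedWidth, two_mul]
  have hA : Nat.log 2 (s.dedup.length + 1) ≤ s.dedup.length :=
    Nat.lt_succ_iff.1 (Nat.log_lt_self 2 (Nat.succ_ne_zero _))
  rw [← List.card_toFinset] at hA
  simp only [codeWord, ← hs, List.length_append, hportals, length_eliasGamma, length_bp,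
    hΥ, ← hm]
  rw [← List.card_toFinset]
  simp only [mul_add] at htable ⊢
  omega

/-- There are at most `4 ^ k` trees with `k` nodes, by the bound on central binomial coefficients;
the sum over `k` is geometric. -/
theorem card_le_four_pow (K : ℕ) (S : Finset (BinaryTree Unit)) (hS : ∀ s ∈ S, s.numNodes ≤ K) :
    S.card ≤ 4 ^ (K + 1) := by
  have hsub : S ⊆ (Finset.range (K + 1)).biUnion BinaryTree.treesOfNumNodesEq := by
    intro s hs
    refine Finset.mem_biUnion.2 ⟨s.numNodes, Finset.mem_range_succ_iff.2 (hS s hs), ?_⟩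
    exact BinaryTree.mem_treesOfNumNodesEq_numNodes s
  have hgeom : ∀ k : ℕ, ∑ i ∈ Finset.range k, 4 ^ i ≤ 4 ^ k := by
    intro k
    induction k with
    | zero => simp
    | succ k ih =>
      rw [Finset.sum_range_succ, pow_succ]
      omega
  refine (Finset.card_le_card hsub).trans (Finset.card_biUnion_le.trans
    ((Finset.sum_le_sum fun k _ => ?_).trans (hgeom _)))
  rw [BinaryTree.treesOfNumNodesEq_card_eq_catalan]
  refine le_trans ?_ (Nat.centralBinom_le_four_pow k)
  rw [← succ_mul_catalan_eq_centralBinom]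
  exact Nat.le_mul_of_pos_left _ (Nat.succ_pos k)

/-- A Huffman code for a list of trees with at most `K` nodes, compared with a source. -/
theorem IsHuffmanCode.sum_length_le_of_isSource {G : ℕ → ℕ → ℕ} {p : ℕ → ℕ → ℝ}
    (hG : IsSizeRule G) (hp : IsSource G p) {s : List (BinaryTree Unit)}
    {C : BinaryTree Unit → List Bool} (hC : IsHuffmanCode s C) (K : ℕ)
    (hK : ∀ σ ∈ s, σ.numNodes ≤ K) (hpos : ∀ σ ∈ s, 0 < treeProb G p σ) :
    ((s.map fun σ => (C σ).length).sum : ℝ) ≤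
      -Real.logb 2 (s.map (treeProb G p)).prod + s.length * (Real.logb 2 (K + 1) + 1) := by
  have hK0 : (0 : ℝ) < K + 1 := by positivity
  -- Shannon lengths for the weights `P[σ] / (K + 1)`. The division is needed because shapes of
  -- different measures occur together; it costs `lg (K + 1)` bits per tree, and rounding up costs
  -- one more.
  have hlen : ∀ σ ∈ s, (1 / 2 : ℝ) ^ ⌈Real.logb 2 ((K + 1) / treeProb G p σ)⌉₊ ≤
      treeProb G p σ / (K + 1) := by
    intro σ hσ
    have h1 := Nat.le_ceil (Real.logb 2 ((K + 1) / treeProb G p σ))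
    rw [Real.logb_le_iff_le_rpow one_lt_two (div_pos hK0 (hpos σ hσ)), Real.rpow_natCast] at h1
    rw [one_div_pow, ← one_div_div ((K : ℝ) + 1)]
    exact one_div_le_one_div_of_le (div_pos hK0 (hpos σ hσ)) h1
  have hkraft : ∑ σ ∈ s.toFinset, (1 / 2 : ℝ) ^ ⌈Real.logb 2 ((K + 1) / treeProb G p σ)⌉₊ ≤ 1 := by
    refine (Finset.sum_le_sum fun σ hσ => hlen σ (List.mem_toFinset.1 hσ)).trans ?_
    rw [← Finset.sum_div, div_le_one hK0]
    exact hp.sum_treeProb_le hG K _ fun σ hσ => hK σ (List.mem_toFinset.1 hσ)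
  have h := hC.sum_length_le _ hkraft
  refine (Nat.cast_le.2 h).trans ?_
  clear h hkraft hlen hK hC
  induction s with
  | nil => simp
  | cons σ s ih =>
    have ih := ih fun τ hτ => hpos τ (List.mem_cons_of_mem _ hτ)
    have hσ := hpos σ List.mem_cons_self
    have hprod : 0 < (s.map (treeProb G p)).prod := by
      refine List.prod_pos fun x hx => ?_
      obtain ⟨τ, hτ, rfl⟩ := List.mem_map.1 hx
      exact hpos τ (List.mem_cons_of_mem _ hτ)
    have h0 : 0 ≤ Real.logb 2 ((K + 1) / treeProb G p σ) := by
      refine Real.logb_nonneg one_lt_two ?_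
      rw [one_le_div hσ]
      have := hp.treeProb_le_one σ
      have : (0 : ℝ) ≤ K := Nat.cast_nonneg K
      linarith
    have h1 := (Nat.ceil_lt_add_one h0).le
    rw [Real.logb_div hK0.ne' hσ.ne'] at h1
    rw [List.map_cons, List.sum_cons, List.map_cons, List.prod_cons,
      Real.logb_mul hσ.ne' hprod.ne', List.length_cons, Real.logb_div hK0.ne' hσ.ne']
    push_cast at ih ⊢
    linarith

/-- The redundancy of the hypersuccinct code. -/
noncomputable def redundancy (n : ℕ) : ℝ :=
  4 * Real.logb 2 (n + 1) + 3 + 4 ^ (2 * blockParam n + 2) * (32 * blockParam n + 32) +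
    (4 * n / blockParam n + 1) * (4 + Real.logb 2 (2 * blockParam n + 2) + 2 * portalWidth n)

theorem length_microTrees_le (t : BinaryTree Unit) :
    ((microTrees t).length : ℝ) ≤ 4 * t.numNodes / blockParam t.numNodes + 1 := by
  rcases Nat.eq_zero_or_pos (blockParam t.numNodes) with h | h
  · have hn : t.numNodes ≤ 1 := by
      by_contra hcon
      push Not at hcon
      have : 0 < Real.logb 2 (t.numNodes : ℝ) :=
        Real.logb_pos one_lt_two (by exact_mod_cast hcon)
      rw [blockParam, Nat.ceil_eq_zero] at h
      linarith
    have := (length_microShapes_le (blockParam t.numNodes) t).trans hn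
    rw [h]
    simp only [Nat.cast_zero, div_zero, zero_add]
    rw [microTrees]
    exact_mod_cast this
  · have h1 : (blockParam t.numNodes : ℝ) * (microTrees t).length ≤
        4 * t.numNodes + blockParam t.numNodes := by
      exact_mod_cast mul_length_microShapes_le (blockParam t.numNodes) t
    have h2 : (0 : ℝ) < blockParam t.numNodes := Nat.cast_pos.2 h
    rw [div_add_one h2.ne', le_div_iff₀ h2]
    linarith

/-- The length of the hypersuccinct code of a tree of positive probability. -/
theorem IsHypersuccinctCode.length_le {G : ℕ → ℕ → ℕ} {p : ℕ → ℕ → ℝ} (hG : IsSizeRule G)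
    (hp : IsSource G p) (hm : IsMonotonic p) {H : BinaryTree Unit → List Bool}
    (hH : IsHypersuccinctCode H) (t : BinaryTree Unit) (ht : 0 < treeProb G p t) :
    ((H t).length : ℝ) ≤ Real.logb 2 (1 / treeProb G p t) + redundancy t.numNodes := by
  obtain ⟨C, hC, hHt⟩ := hH t
  have hm1 := length_microTrees_le t
  have hm2 : (microTrees t).length ≤ t.numNodes := length_microShapes_le _ t
  have hK : ∀ σ ∈ microTrees t, σ.numNodes ≤ 2 * blockParam t.numNodes + 1 :=
    numNodes_le_of_mem_microShapes _ t
  have hprod : treeProb G p t ≤ ((microTrees t).map (treeProb G p)).prod :=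
    hp.treeProb_le_prod_microShapes hG hm _ t
  have hlen := length_codeWord_le t.numNodes (portalWidth t.numNodes)
    (2 * blockParam t.numNodes + 1) C (topTier (blockParam t.numNodes) t) (microTrees t) rfl hK
  rw [← hHt] at hlen
  have hcard := card_le_four_pow (2 * blockParam t.numNodes + 1) (microTrees t).toFinset
    fun σ hσ => hK σ (List.mem_toFinset.1 hσ)
  -- Submultiplicativity also guarantees that every Shannon length is meaningful: a micro tree of
  -- probability zero would make `P[t]` vanish.
  have hpos : ∀ σ ∈ microTrees t, 0 < treeProb G p σ := by
    intro σ hσ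
    refine lt_of_le_of_ne (hp.treeProb_nonneg σ) fun h => ?_
    have : ((microTrees t).map (treeProb G p)).prod = 0 :=
      List.prod_eq_zero (List.mem_map.2 ⟨σ, hσ, h.symm⟩)
    linarith
  have hcode := hC.sum_length_le_of_isSource hG hp _ hK hpos
  have hlog := Real.logb_le_logb_of_le one_lt_two ht hprod
  rw [one_div, Real.logb_inv]
  have hlog1 := Real.natLog_le_logb (t.numNodes + 1) 2
  have hlog2 : Nat.log 2 ((microTrees t).length + 1) ≤ Nat.log 2 (t.numNodes + 1) :=
    Nat.log_mono_right (by omega)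
  unfold redundancy
  generalize microTrees t = s at *
  generalize t.numNodes = n at *
  generalize blockParam n = B at *
  generalize portalWidth n = w at *
  -- Here `K = 2 * B + 1`, and the gamma codes of `n + 1` and `m + 1` are treated alike because `m ≤
  -- n`.
  have hlen' : ((H t).length : ℝ) ≤ 4 * Nat.log 2 (n + 1) + 3 +
      s.toFinset.card * (32 * B + 32) + s.length * (3 + 2 * w) +
        ((s.map fun σ => (C σ).length).sum : ℕ) := by
    have : (H t).length ≤ 4 * Nat.log 2 (n + 1) + 3 +
      s.toFinset.card * (32 * B + 32) + s.length * (3 + 2 * w) +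
        (s.map fun σ => (C σ).length).sum := by
      refine hlen.trans ?_
      rw [show 16 * (2 * B + 1) + 16 = 32 * B + 32 by ring]
      omega
    exact_mod_cast this
  have hcard' : (s.toFinset.card : ℝ) * (32 * B + 32) ≤ 4 ^ (2 * B + 2) * (32 * B + 32) := by
    refine mul_le_mul_of_nonneg_right ?_ (by positivity)
    exact_mod_cast hcard
  have hN : 0 ≤ Real.logb 2 (2 * (B : ℝ) + 2) := by
    refine Real.logb_nonneg one_lt_two ?_
    have : (0 : ℝ) ≤ B := Nat.cast_nonneg B
    linarith
  have hm' := mul_le_mul_of_nonneg_right hm1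
    (by positivity : 0 ≤ 4 + Real.logb 2 (2 * (B : ℝ) + 2) + 2 * (w : ℝ))
  push_cast at hcode hlog1 hlen'
  rw [show 2 * (B : ℝ) + 1 + 1 = 2 * B + 2 by ring] at hcode
  linarith

/-! ### Asymptotics of the redundancy -/

theorem logb_two_le {x : ℝ} (hx : 1 ≤ x) : Real.logb 2 x ≤ 2 * Real.log x := by
  have h := Real.log_nonneg hx
  have h2 := Real.log_two_gt_d9
  rw [Real.logb, div_le_iff₀ (by linarith)]
  nlinarith

theorem log_le_logb_two {x : ℝ} (hx : 1 ≤ x) : Real.log x ≤ Real.logb 2 x := by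
  have h := Real.log_nonneg hx
  have h2 := Real.log_two_lt_d9
  have h3 := Real.log_two_gt_d9
  rw [Real.logb, le_div_iff₀ (by linarith)]
  nlinarith

theorem redundancy_nonneg (n : ℕ) : 0 ≤ redundancy n := by
  have h1 : 0 ≤ Real.logb 2 ((n : ℝ) + 1) :=
    Real.logb_nonneg one_lt_two (by have : (0 : ℝ) ≤ n := Nat.cast_nonneg n; linarith)
  have h2 : 0 ≤ Real.logb 2 (2 * (blockParam n : ℝ) + 2) :=
    Real.logb_nonneg one_lt_two
      (by have : (0 : ℝ) ≤ blockParam n := Nat.cast_nonneg _; linarith)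
  unfold redundancy
  positivity

theorem redundancy_le {n : ℕ} (h3 : 3 ≤ Real.log n) (hsq : Real.log n ^ 2 ≤ √n) :
    redundancy n ≤ 20000 * (n * Real.log (Real.log n) / Real.log n) := by
  have hn0 : (n : ℝ) ≠ 0 := by
    rintro h
    rw [h, Real.log_zero] at h3
    linarith
  have hn1 : (1 : ℝ) ≤ n := by exact_mod_cast Nat.one_le_iff_ne_zero.2 (by exact_mod_cast hn0)
  have hlog := logb_two_le hn1
  have hlog' := log_le_logb_two hn1
  have hB1 : Real.logb 2 n / 8 ≤ blockParam n := Nat.le_ceil _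
  have hB2 : (blockParam n : ℝ) < Real.logb 2 n / 8 + 1 :=
    Nat.ceil_lt_add_one (by linarith)
  have hμ : (microBound n : ℝ) < Real.logb 2 n / 4 + 1 :=
    Nat.ceil_lt_add_one (by linarith)
  have hμ0 : (0 : ℝ) ≤ microBound n := Nat.cast_nonneg _
  have hw : (portalWidth n : ℝ) < Real.logb 2 ((microBound n : ℝ) + 1) + 1 :=
    Nat.ceil_lt_add_one (Real.logb_nonneg one_lt_two (by linarith))
  -- The choice of an eighth of `lg n` for `B` enters here: `4 B + 4 ≤ (lg n) / 2 + 8`, so the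
  -- number of shapes is of order `√n`.
  have hpow : (4 : ℝ) ^ (2 * blockParam n + 2) ≤ 256 * √n := by
    have h : (4 : ℝ) ^ (2 * blockParam n + 2) = (2 : ℝ) ^ (4 * (blockParam n : ℝ) + 4) := by
      rw [show (4 : ℝ) = 2 ^ 2 by norm_num, ← pow_mul, ← Real.rpow_natCast]
      push_cast
      ring_nf
    rw [h]
    refine (Real.rpow_le_rpow_of_exponent_le one_le_two
      (by linarith : 4 * (blockParam n : ℝ) + 4 ≤ Real.logb 2 n * (1 / 2) + 8)).trans ?_
    rw [Real.rpow_add two_pos, Real.rpow_mul two_pos.le,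
      Real.rpow_logb two_pos (by norm_num) (by linarith), ← Real.sqrt_eq_rpow]
    norm_num
    linarith
  unfold redundancy
  have hL0 : 0 < Real.log n := by linarith
  have hℓ : 1 ≤ Real.log (Real.log n) := by
    rw [Real.le_log_iff_exp_le hL0]
    linarith [Real.exp_one_lt_d9]
  have hlogsq : 2 * Real.log (Real.log n ^ 2) = 4 * Real.log (Real.log n) := by
    rw [Real.log_pow]
    push_cast
    ring
  have hw' : (portalWidth n : ℝ) ≤ 5 * Real.log (Real.log n) := by
    have h1 := logb_two_le (x := (microBound n : ℝ) + 1) (by linarith)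
    have h2 : Real.log ((microBound n : ℝ) + 1) ≤ Real.log (Real.log n ^ 2) :=
      Real.log_le_log (by linarith) (by nlinarith)
    linarith
  have hN' : Real.logb 2 (2 * (blockParam n : ℝ) + 2) ≤ 4 * Real.log (Real.log n) := by
    have h1 := logb_two_le (x := 2 * (blockParam n : ℝ) + 2) (by linarith)
    have h2 : Real.log (2 * (blockParam n : ℝ) + 2) ≤ Real.log (Real.log n ^ 2) :=
      Real.log_le_log (by linarith) (by nlinarith)
    linarith
  have hn1' : Real.logb 2 ((n : ℝ) + 1) ≤ 4 * Real.log n := by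
    have hn2 : (2 : ℝ) ≤ n := by linarith [Real.log_le_sub_one_of_pos (by linarith : (0 : ℝ) < n)]
    have h1 := logb_two_le (x := (n : ℝ) + 1) (by linarith)
    have h2 : Real.log ((n : ℝ) + 1) ≤ Real.log ((n : ℝ) ^ 2) :=
      Real.log_le_log (by linarith) (by nlinarith)
    rw [Real.log_pow] at h2
    push_cast at h2
    linarith
  have hs : √(n : ℝ) * √(n : ℝ) = n := Real.mul_self_sqrt (by linarith)
  generalize Real.logb 2 (2 * (blockParam n : ℝ) + 2) = N at *
  generalize Real.logb 2 ((n : ℝ) + 1) = N₁ at *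
  generalize (4 : ℝ) ^ (2 * blockParam n + 2) = P at *
  generalize (blockParam n : ℝ) = B at *
  generalize (portalWidth n : ℝ) = w at *
  generalize Real.log (Real.log n) = ℓ at *
  generalize Real.log (n : ℝ) = L at *
  generalize √(n : ℝ) = q at *
  set D : ℝ := n / L with hD
  -- This absorbs the code table, of order `L * √n`, into `D = n / L`; it is equivalent to `L ^ 2 ≤
  -- √n`.
  have hDq : L * q ≤ D := by
    rw [hD, le_div_iff₀ hL0]
    have hq : 0 ≤ q := (sq_nonneg L).trans hsq
    calc L * q * L = L ^ 2 * q := by ring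
      _ ≤ q * q := mul_le_mul_of_nonneg_right hsq hq
      _ = n := hs
  have hq9 : 9 ≤ q := by nlinarith
  have hLD : L ≤ D := by nlinarith
  have hD1 : 1 ≤ D := by linarith
  have hDℓ : D ≤ D * ℓ := le_mul_of_one_le_right (by linarith) hℓ
  have hBL : 0 < B := by linarith
  have h1 : P * (32 * B + 32) ≤ 256 * q * (64 * L) :=
    mul_le_mul hpow (by linarith) (by linarith) (by linarith)
  have h2 : 4 * (n : ℝ) / B ≤ 32 * D := by
    rw [div_le_iff₀ hBL, hD]
    have : L / 8 ≤ B := by linarith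
    calc 4 * (n : ℝ) = 32 * (n / L) * (L / 8) := by field_simp; norm_num
      _ ≤ 32 * (n / L) * B := mul_le_mul_of_nonneg_left this (by positivity)
  have h3' : (4 * (n : ℝ) / B + 1) * (4 + N + 2 * w) ≤ (33 * D) * (18 * ℓ) := by
    refine (mul_le_mul_of_nonneg_left (by linarith : 4 + N + 2 * w ≤ 18 * ℓ)
      (by positivity)).trans (mul_le_mul_of_nonneg_right (by linarith) (by linarith))
  have h4 : (n : ℝ) * ℓ / L = D * ℓ := by rw [hD]; ring
  -- The constants add up as `19` for the header, `256 * 64 = 16384` for the table and `33 * 18 =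
  -- 594` for the micro trees, in total less than `20000`.
  rw [h4]
  linarith

theorem isBigO_redundancy :
    redundancy =O[Filter.atTop]
      (fun n : ℕ => (n : ℝ) * Real.log (Real.log (n : ℝ)) / Real.log (n : ℝ)) := by
  have hlog : Filter.Tendsto (fun n : ℕ => Real.log (n : ℝ)) Filter.atTop Filter.atTop :=
    Real.tendsto_log_atTop.comp tendsto_natCast_atTop_atTop
  have hsq : ∀ᶠ n : ℕ in Filter.atTop, Real.log (n : ℝ) ^ 2 ≤ √(n : ℝ) := by
    -- The exponent `1 / 4` becomes the square root after squaring.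
    have h := ((isLittleO_log_rpow_atTop (by norm_num : (0 : ℝ) < 1 / 4)).bound
      zero_lt_one)
    filter_upwards [tendsto_natCast_atTop_atTop.eventually h] with n hn
    rw [one_mul, Real.norm_eq_abs, Real.norm_of_nonneg (by positivity)] at hn
    have h2 := pow_le_pow_left₀ (abs_nonneg _) hn 2
    rw [sq_abs, ← Real.rpow_mul_natCast (Nat.cast_nonneg n)] at h2
    rwa [Real.sqrt_eq_rpow, show (1 / 2 : ℝ) = 1 / 4 * (2 : ℕ) by norm_num]
  refine Asymptotics.IsBigO.of_bound 20000 ?_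
  filter_upwards [hlog.eventually_ge_atTop 3, hsq] with n h3 hn
  rw [Real.norm_of_nonneg (redundancy_nonneg n)]
  exact (redundancy_le h3 hn).trans
    (mul_le_mul_of_nonneg_left (Real.le_norm_self _) (by norm_num))

end Hypersuccinct

/-! ### Universality for monotonic sources -/

theorem mainTheorem7 :
    -- the redundancy bound, with one error term for all codes, sources and trees
    (∃ R : ℕ → ℝ,
      R =O[Filter.atTop]
        (fun n : ℕ => (n : ℝ) * Real.log (Real.log (n : ℝ)) / Real.log (n : ℝ)) ∧
      ∀ H : BinaryTree Unit → List Bool, Hypersuccinct.IsHypersuccinctCode H →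
        ∀ p : ℕ → ℕ → ℝ, Hypersuccinct.IsMonotonic p →
          (Hypersuccinct.IsFixedSizeSource p →
            ∀ n : ℕ, ∀ t ∈ BinaryTree.treesOfNumNodesEq n,
              0 < Hypersuccinct.fixedSizeProb p t →
              ((H t).length : ℝ) ≤
                Real.logb 2 (1 / Hypersuccinct.fixedSizeProb p t) + R n) ∧
          (Hypersuccinct.IsFixedHeightSource p →
            ∀ n : ℕ, ∀ t ∈ BinaryTree.treesOfNumNodesEq n,
              0 < Hypersuccinct.fixedHeightProb p t →
              ((H t).length : ℝ) ≤
                Real.logb 2 (1 / Hypersuccinct.fixedHeightProb p t) + R n)) ∧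
    -- submultiplicativity over the micro trees
    (∀ p : ℕ → ℕ → ℝ, Hypersuccinct.IsMonotonic p →
      (Hypersuccinct.IsFixedSizeSource p → ∀ t : BinaryTree Unit,
        Hypersuccinct.fixedSizeProb p t ≤
          ((Hypersuccinct.microTrees t).map (Hypersuccinct.fixedSizeProb p)).prod) ∧
      (Hypersuccinct.IsFixedHeightSource p → ∀ t : BinaryTree Unit,
        Hypersuccinct.fixedHeightProb p t ≤
          ((Hypersuccinct.microTrees t).map (Hypersuccinct.fixedHeightProb p)).prod)) ∧
    -- random binary search trees are a special case
    (Hypersuccinct.IsFixedSizeSource Hypersuccinct.bstSource ∧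
      Hypersuccinct.IsMonotonic Hypersuccinct.bstSource) ∧
    -- the uniform distribution is a special case
    (Hypersuccinct.IsFixedSizeSource Hypersuccinct.uniformSource ∧
      Hypersuccinct.IsMonotonic Hypersuccinct.uniformSource ∧
      ∀ n : ℕ, ∀ t ∈ BinaryTree.treesOfNumNodesEq n,
        Hypersuccinct.fixedSizeProb Hypersuccinct.uniformSource t =
          1 / ((BinaryTree.treesOfNumNodesEq n).card : ℝ)) := by
  refine ⟨⟨Hypersuccinct.redundancy, Hypersuccinct.isBigO_redundancy, ?_⟩, ?_,
    ⟨Hypersuccinct.isFixedSizeSource_bstSource, Hypersuccinct.isMonotonic_bstSource⟩,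
    Hypersuccinct.isFixedSizeSource_uniformSource, Hypersuccinct.isMonotonic_uniformSource, ?_⟩
  · intro H hH p hm
    refine ⟨fun hp n t ht hpos => ?_, fun hp n t ht hpos => ?_⟩
    · obtain rfl := BinaryTree.mem_treesOfNumNodesEq.1 ht
      rw [← Hypersuccinct.treeProb_add] at hpos ⊢
      exact hH.length_le Hypersuccinct.isSizeRule_add hp.isSource hm t hpos
    · obtain rfl := BinaryTree.mem_treesOfNumNodesEq.1 ht
      rw [← Hypersuccinct.treeProb_max] at hpos ⊢
      exact hH.length_le Hypersuccinct.isSizeRule_max hp.isSource hm t hpos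
  · intro p hm
    refine ⟨fun hp t => ?_, fun hp t => ?_⟩
    · rw [← Hypersuccinct.treeProb_add]
      exact hp.isSource.treeProb_le_prod_microShapes Hypersuccinct.isSizeRule_add hm _ t
    · rw [← Hypersuccinct.treeProb_max]
      exact hp.isSource.treeProb_le_prod_microShapes Hypersuccinct.isSizeRule_max hm _ t
  · intro n t ht
    obtain rfl := BinaryTree.mem_treesOfNumNodesEq.1 ht
    rw [Hypersuccinct.fixedSizeProb_uniformSource,
      BinaryTree.treesOfNumNodesEq_card_eq_catalan]
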